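/- For $d\ge 0$ let $R_d$ be the plane graph defined recursively as follows. $R_0$ is a triangle $a_0b_0c_0$. To get $R_{d+1}$ from $R_d$, subdivide each edge $\{x_d,y_d\}$ of the innermost triangle $a_db_dc_d$ by a new node $z'_d$ ($\{x,y,z\}=\{a,b,c\}$), put a new triangle $a_{d+1}b_{d+1}c_{d+1}$ inside, and add the edges $\{x'_d,x_{d+1}\}$ for $x\in\{a,b,c\}$. For a cubic plane graph $G$, let $R_d(G)$ be obtained by replacing each vertex of $G$ by a copy of $R_d$, whose nodes $a_0,b_0,c_0$ receive the three edges of $G$ at that vertex. For a plane triangulation $G$, with plane dual $G^*$, let $T_d(G)=(R_d(G^*))^*$; each vertex of $G$ (a face of $G^*$) corresponds to a vertex of $T_d(G)$, called original. Put $H_d=T_d(K_4)$. For a connected graph $G$ on $n$ vertices let $P_2(G)$ be the set of ordered pairs $(A,B)$ of disjoint, possibly empty sets with union $V(G)$, each of which induces a connected subgraph (the empty set counts as connected). The (ordered) flip walk on $P_2(G)$ does the following at each step: with probability $1/2$ it stays; otherwise it picks a uniformly random vertex, moves it to the other block if both blocks remain connected, and stays if they do not. The unordered flip walk is the induced quotient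 chain on unordered partitions $\{A,B\}$. The uniform distribution is stationary for both. For a chain with transition matrix $K$ and stationary distribution $\mu$, let $t_{mix}(\epsilon)=\inf\{t\in\mathbb{N}:\max_x\|K^t(x,\cdot)-\mu\|_{TV}\le\epsilon\}$. Then: 1. For every $d$, $H_d$ is a triangulation of the plane (a simple plane graph all of whose faces are triangles) and a maximal planar graph, and all its vertices have degree at most $9$. 2. $|V(H_d)|=O(d)$ as $d\to\infty$. 3. For every $d$, both the ordered and the unordered flip walk on $H_d$ have mixing time $t_{mix}(1/4)\ge 5^d/250$. 4. There are partitions in $P_2(K_4)$ for which every face of $K_4$ is mixed, that is, has vertices in both blocks. Let $P$ be any of them, and let $U$ be the set of all partitions in $P_2(H_d)$ whose restriction to the original vertices is $P$. Then $U$ is a bottleneck set for the ordered walk: $U$ is nonempty, contains at most half of the states, and satisfies $$\frac{|\partial_E U|}{2\,|V(H_d)|\,|U|}\le\tfrac12\,5^{3-d},$$ where $\partial_E U$ is the set of edges of the flip graph that leave $U$. The image of $U$ in the set of unordered partitions has the same three properties for the unordered walk. -/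

import Mathlib

open scoped ENNReal symmDiff

/-! Maps on closed surfaces, given by their darts (oriented edges). -/

/-- A combinatorial map with set of darts `D`: `σ` sends a dart to the next dart around its
origin, and `α` reverses darts. -/
structure CombMap (D : Type) where
  σ : Equiv.Perm D
  α : Equiv.Perm D
  α_invol : ∀ x, α (α x) = x
  α_ne : ∀ x, α x ≠ x

namespace CombMap

variable {D : Type}

/-- The next dart along the boundary of the face that is incident to a dart. -/
def φ (M : CombMap D) : Equiv.Perm D := M.σ * M.α

/-- Vertices, edges and faces are the cycles of `σ`, `α` and `φ = σ ∘ α`. -/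
def Vertex (M : CombMap D) : Type := Quotient (Equiv.Perm.SameCycle.setoid M.σ)

def Edge (M : CombMap D) : Type := Quotient (Equiv.Perm.SameCycle.setoid M.α)

def Face (M : CombMap D) : Type := Quotient (Equiv.Perm.SameCycle.setoid M.φ)

/-- The origin of a dart. -/
def origin (M : CombMap D) (x : D) : M.Vertex := Quotient.mk _ x

/-- The face whose boundary walk passes through a dart. -/
def face (M : CombMap D) (x : D) : M.Face := Quotient.mk _ x

instance [Finite D] (M : CombMap D) : Finite M.Vertex := Quotient.finite _

instance [Finite D] (M : CombMap D) : Finite M.Face := Quotient.finite _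

/-- The underlying graph. -/
def graph (M : CombMap D) : SimpleGraph M.Vertex where
  Adj u v := u ≠ v ∧ ∃ x, M.origin x = u ∧ M.origin (M.α x) = v
  symm := ⟨fun _ _ h => by
    obtain ⟨hne, x, hx, hy⟩ := h
    exact ⟨hne.symm, M.α x, hy, by rw [M.α_invol]; exact hx⟩⟩
  loopless := ⟨fun _ h => h.1 rfl⟩

/-- The surface is a sphere: the map is connected and has Euler characteristic `2`. -/
def IsPlane (M : CombMap D) : Prop :=
  MulAction.IsPretransitive (Subgroup.closure {M.σ, M.α}) D ∧
    Nat.card M.Vertex + Nat.card M.Face = Nat.card M.Edge + 2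

/-- Neither loops nor parallel edges. -/
def IsSimple (M : CombMap D) : Prop :=
  (∀ x, M.origin (M.α x) ≠ M.origin x) ∧
    ∀ x y, M.origin x = M.origin y → M.origin (M.α x) = M.origin (M.α y) → x = y

/-- A triangulation of the plane: a simple plane map all of whose faces (the unbounded one
included) are bounded by three edges. -/
def IsTriangulation (M : CombMap D) : Prop :=
  M.IsPlane ∧ M.IsSimple ∧ ∀ f : M.Face, {x | M.face x = f}.ncard = 3

/-- The dual map: its vertices are the faces of `M`, its faces are the vertices of `M`, and each
edge joins the two faces that it separates in `M`. -/
def dual (M : CombMap D) : CombMap D where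
  σ := M.φ
  α := M.α
  α_invol := M.α_invol
  α_ne := M.α_ne

/-- Nodes of the gadgets that replace the vertices. If `x` is a dart at the cubic vertex `v`, so
that `x`, `σ x`, `σ⁻¹ x` play the role of the letters `a`, `b`, `c`, then `(x, inl k)` is the node
`x_k` (`0 ≤ k ≤ d`) and `(x, inr k)` is the node `x'_k` (`0 ≤ k < d`) of the copy of `R_d` put at
`v`. Each node has three darts, listed in the order of the rotation around it:
* at `x_k`: `0` points outwards, `1` towards the side of `σ x`, `2` towards the side of `σ⁻¹ x`;
* at `x'_k`, which lies between `(σ x)_k` and `(σ⁻¹ x)_k`: `0` points inwards (to `x_{k+1}`),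
  `1` to `(σ x)_k`, and `2` to `(σ⁻¹ x)_k`. -/
abbrev GadgetDart (D : Type) (d : ℕ) : Type := D × (Fin (d + 1) ⊕ Fin d) × Fin 3

/-- Reversal of the darts after the replacement. The edges are: the original edges
`{x_0, (α x)_0}`; the edges `{x'_k, x_{k+1}}`; the two halves `{x'_k, (σ x)_k}`,
`{x'_k, (σ⁻¹ x)_k}` of the subdivided edge `{(σ x)_k, (σ⁻¹ x)_k}` for `k < d`; and the edges
`{x_d, (σ x)_d}` of the innermost triangle. -/
def gadgetRev (M : CombMap D) (d : ℕ) : GadgetDart D d → GadgetDart D d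
  | (x, Sum.inl k, 0) =>
      if h : k = 0 then (M.α x, Sum.inl 0, 0) else (x, Sum.inr (k.pred h), 0)
  | (x, Sum.inl k, 1) =>
      if h : k = Fin.last d then (M.σ x, Sum.inl (Fin.last d), 2)
      else (M.σ.symm x, Sum.inr (k.castPred h), 1)
  | (x, Sum.inl k, 2) =>
      if h : k = Fin.last d then (M.σ.symm x, Sum.inl (Fin.last d), 1)
      else (M.σ x, Sum.inr (k.castPred h), 2)
  | (x, Sum.inr k, 0) => (x, Sum.inl k.succ, 0)
  | (x, Sum.inr k, 1) => (M.σ x, Sum.inl k.castSucc, 1)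
  | (x, Sum.inr k, 2) => (M.σ.symm x, Sum.inl k.castSucc, 2)

theorem gadgetRev_invol (M : CombMap D) (d : ℕ) :
    Function.Involutive (M.gadgetRev d) := by
  rintro ⟨x, k | k, i⟩
  · fin_cases i
    · by_cases h : k = 0
      · simp [gadgetRev, h, M.α_invol]
      · simp [gadgetRev, h]
    · by_cases h : k = Fin.last d
      · simp [gadgetRev, h]
      · simp [gadgetRev, h]
    · by_cases h : k = Fin.last d
      · simp [gadgetRev, h]
      · simp [gadgetRev, h]
  · fin_cases i
    · simp [gadgetRev]
    · simp [gadgetRev, Fin.castSucc_ne_last]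
    · simp [gadgetRev, Fin.castSucc_ne_last]

theorem gadgetRev_ne (M : CombMap D) (d : ℕ) (y : GadgetDart D d) : M.gadgetRev d y ≠ y := by
  obtain ⟨x, k | k, i⟩ := y
  · fin_cases i
    · by_cases h : k = 0
      · simp [gadgetRev, h, M.α_ne]
      · simp [gadgetRev, h]
    · by_cases h : k = Fin.last d
      · simp [gadgetRev, h]
      · simp [gadgetRev, h]
    · by_cases h : k = Fin.last d
      · simp [gadgetRev, h]
      · simp [gadgetRev, h]
  · fin_cases i <;> simp [gadgetRev]

/-- `R_d(M)` for a cubic map `M`: every vertex is replaced by a copy of the gadget `R_d`, drawn as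
nested triangles around the place of the vertex. -/
def replaceVertices (M : CombMap D) (d : ℕ) : CombMap (GadgetDart D d) where
  σ := (Equiv.refl D).prodCongr ((Equiv.refl _).prodCongr (Equiv.addRight 1))
  α := (M.gadgetRev_invol d).toPerm
  α_invol := M.gadgetRev_invol d
  α_ne := M.gadgetRev_ne d

/-- `T_d(M) = (R_d(M^*))^*` for a triangulation `M`. -/
def refineFaces (M : CombMap D) (d : ℕ) : CombMap (GadgetDart D d) :=
  (M.dual.replaceVertices d).dual

/-- The vertex of `T_d(M)` that corresponds to the origin of the dart `x` of `M`: the vertices of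
`M` are the faces of `M^*`, and such a face extends to the face of `R_d(M^*)` incident to the
original edges that bound it. -/
def originalVertex (M : CombMap D) (d : ℕ) (x : D) : (M.refineFaces d).Vertex :=
  (M.refineFaces d).origin (x, Sum.inl 0, 0)

end CombMap

/-- Planarity of a finite graph: some choice of a cyclic order of the edges around each vertex
makes every component a map on the sphere (an isolated vertex counts as a component with one
face). -/
def IsPlanarGraph {V : Type} (G : SimpleGraph V) : Prop :=
  ∃ M : CombMap G.Dart, (∀ x, M.α x = x.symm) ∧
    (∀ x y, M.origin x = M.origin y ↔ x.fst = y.fst) ∧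
    Nat.card V + (Nat.card M.Face + {v | ∀ w, ¬ G.Adj v w}.ncard) =
      Nat.card G.edgeSet + 2 * Nat.card G.ConnectedComponent

/-- A planar graph to which no edge can be added. -/
def IsMaximalPlanar {V : Type} (G : SimpleGraph V) : Prop :=
  IsPlanarGraph G ∧ ∀ G' : SimpleGraph V, G < G' → ¬ IsPlanarGraph G'

/-- The next vertex after `j` around the vertex `i` of the plane graph `K_4` (for `j ≠ i`). -/
def tetraNext : Fin 4 → Equiv.Perm (Fin 4)
  | 0 => c[1, 2, 3]
  | 1 => c[0, 3, 2]
  | 2 => c[0, 1, 3]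
  | 3 => c[0, 2, 1]

/-- The plane graph `K_4` on the vertices `0, 1, 2, 3`; the darts are the ordered pairs of distinct
vertices. -/
def tetra : CombMap {p : Fin 4 × Fin 4 // p.1 ≠ p.2} where
  σ :=
    { toFun := fun p => ⟨(p.1.1, tetraNext p.1.1 p.1.2), by revert p; decide⟩
      invFun := fun p => ⟨(p.1.1, (tetraNext p.1.1).symm p.1.2), by revert p; decide⟩
      left_inv := fun p => by simp
      right_inv := fun p => by simp }
  α :=
    { toFun := fun p => ⟨(p.1.2, p.1.1), p.2.symm⟩
      invFun := fun p => ⟨(p.1.2, p.1.1), p.2.symm⟩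
      left_inv := fun _ => rfl
      right_inv := fun _ => rfl }
  α_invol := fun _ => rfl
  α_ne := fun p h => p.2 (congrArg (fun q => q.1.2) h)

/-- The family `H_d = T_d(K_4)`. -/
def tetraRefined (d : ℕ) : CombMap (CombMap.GadgetDart {p : Fin 4 × Fin 4 // p.1 ≠ p.2} d) :=
  tetra.refineFaces d

/-! Connected partitions and the flip walk. -/

section Partitions

variable {V : Type} (G : SimpleGraph V)

/-- `A` and its complement both induce connected subgraphs (the empty block is allowed). -/
def IsConnSplit (A : Set V) : Prop :=
  (G.induce A).Preconnected ∧ (G.induce Aᶜ).Preconnected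

/-- The ordered connected `2`-partitions `(A, Aᶜ)`, with first block `A = block`. -/
@[ext]
structure ConnPartition where
  block : Set V
  conn : IsConnSplit G block

variable {G}

namespace ConnPartition

/-- The partition with its two blocks exchanged. -/
def swap (P : ConnPartition G) : ConnPartition G :=
  ⟨P.blockᶜ, P.conn.2, by rw [compl_compl]; exact P.conn.1⟩

theorem swap_swap (P : ConnPartition G) : P.swap.swap = P := ConnPartition.ext (compl_compl _)

open Classical in
/-- Move the vertex `x` to the other block if both blocks remain connected; otherwise stay. -/
noncomputable def flip (P : ConnPartition G) (x : V) : ConnPartition G :=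
  if h : IsConnSplit G (P.block ∆ {x}) then ⟨P.block ∆ {x}, h⟩ else P

theorem swap_flip (P : ConnPartition G) (x : V) : P.swap.flip x = (P.flip x).swap := by
  have e : (P.swap.block ∆ {x} : Set V) = (P.block ∆ {x})ᶜ := by
    ext y
    simp only [swap, Set.mem_symmDiff, Set.mem_compl_iff, Set.mem_singleton_iff]
    tauto
  have e2 : IsConnSplit G (P.swap.block ∆ {x}) ↔ IsConnSplit G (P.block ∆ {x}) := by
    rw [e]; unfold IsConnSplit; rw [compl_compl]; exact and_comm
  by_cases h : IsConnSplit G (P.block ∆ {x})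
  · rw [flip, flip, dif_pos h, dif_pos (e2.2 h)]
    exact ConnPartition.ext e
  · rw [flip, flip, dif_neg h, dif_neg fun k => h (e2.1 k)]

end ConnPartition

instance [Finite V] : Finite (ConnPartition G) :=
  Finite.of_injective ConnPartition.block fun _ _ h => ConnPartition.ext h

noncomputable instance [Finite V] : Fintype (ConnPartition G) := Fintype.ofFinite _

noncomputable instance : DecidableEq (ConnPartition G) := Classical.decEq _

variable (G)

/-- Partitions are identified with those obtained by exchanging the blocks. -/
def swapSetoid : Setoid (ConnPartition G) where
  r P Q := P = Q ∨ P = Q.swap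
  iseqv :=
    { refl := fun _ => Or.inl rfl
      symm := fun {P Q} h => by
        rcases h with h | h
        · exact Or.inl h.symm
        · exact Or.inr (by rw [h, ConnPartition.swap_swap])
      trans := fun {P Q R} h k => by
        rcases h with rfl | rfl
        · exact k
        · rcases k with rfl | rfl
          · exact Or.inr rfl
          · exact Or.inl (ConnPartition.swap_swap _) }

/-- The unordered connected `2`-partitions `{A, B}`. -/
def UnorderedConnPartition : Type := Quotient (swapSetoid G)

variable {G}

/-- Forget the order of the blocks. -/
def ConnPartition.unorder (P : ConnPartition G) : UnorderedConnPartition G := Quotient.mk _ P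

theorem ConnPartition.unorder_swap (P : ConnPartition G) : P.swap.unorder = P.unorder :=
  Quotient.sound (s := swapSetoid G) (Or.inr rfl)

instance [Finite V] : Finite (UnorderedConnPartition G) := Quotient.finite _

noncomputable instance [Finite V] : Fintype (UnorderedConnPartition G) := Fintype.ofFinite _

noncomputable instance : DecidableEq (UnorderedConnPartition G) := Classical.decEq _

variable (G)

/-- The flip walk on ordered partitions: the lazy simple random walk on the `|V|`-regular graph
whose edges at `P` are the flips of `P`, one for each vertex. -/
noncomputable def flipWalk [Finite V] : Matrix (ConnPartition G) (ConnPartition G) ℝ :=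
  Matrix.of fun P Q =>
    (1 / 2) * (if P = Q then 1 else 0) +
      (1 / 2) * ({x | P.flip x = Q}.ncard / Nat.card V : ℝ)

/-- The same walk on unordered partitions (the quotient of the flip walk by `swap`). -/
noncomputable def unorderedFlipWalk [Finite V] :
    Matrix (UnorderedConnPartition G) (UnorderedConnPartition G) ℝ :=
  Matrix.of fun p q =>
    Quotient.lift
      (fun P : ConnPartition G =>
        (1 / 2) * (if P.unorder = q then 1 else 0) +
          (1 / 2) * ({x | (P.flip x).unorder = q}.ncard / Nat.card V : ℝ))
      (by
        rintro P Q (rfl | rfl)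
        · rfl
        · simp only [ConnPartition.swap_flip, ConnPartition.unorder_swap]) p

end Partitions

/-! Mixing of finite Markov chains, given by their transition matrices. -/

section Markov

variable {Ω : Type} [Fintype Ω]

/-- `μ` is a probability distribution on `Ω` that is stationary for the chain `K`. -/
def IsStationaryDist (K : Matrix Ω Ω ℝ) (μ : Ω → ℝ) : Prop :=
  (∀ x, 0 ≤ μ x) ∧ ∑ x, μ x = 1 ∧ Matrix.vecMul μ K = μ

/-- The uniform distribution. -/
noncomputable def uniformDist (Ω : Type) [Fintype Ω] : Ω → ℝ := fun _ => 1 / Fintype.card Ω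

/-- Total variation distance. -/
noncomputable def tvDist (μ ν : Ω → ℝ) : ℝ := (1 / 2) * ∑ x, |μ x - ν x|

variable [DecidableEq Ω]

/-- The largest distance from `μ` at time `t`, over all starting points. -/
noncomputable def worstDist (K : Matrix Ω Ω ℝ) (μ : Ω → ℝ) (t : ℕ) : ℝ :=
  ⨆ x, tvDist ((K ^ t) x) μ

/-- The mixing time with respect to the stationary distribution `μ` (infinite if the chain never
gets that close to `μ`). -/
noncomputable def mixingTime (K : Matrix Ω Ω ℝ) (μ : Ω → ℝ) (ε : ℝ) : ℝ≥0∞ :=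
  ⨅ (t : ℕ) (_ : worstDist K μ t ≤ ε), (t : ℝ≥0∞)

open Classical in
/-- The quantity `|∂_E U| / (2 n |U|)` for the lazy walk `K` on an `n`-regular graph, in which
each edge out of `U` is crossed with probability `1 / (2 n)`. -/
noncomputable def escapeRatio (K : Matrix Ω Ω ℝ) (U : Set Ω) : ℝ :=
  (∑ x, ∑ y, if x ∈ U ∧ y ∉ U then K x y else 0) / U.ncard

/-- `U` contains at most half of the states, and its edge boundary is at most the fraction `r` of
its volume. -/
def IsBottleneck (K : Matrix Ω Ω ℝ) (U : Set Ω) (r : ℝ) : Prop :=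
  U.Nonempty ∧ 2 * U.ncard ≤ Fintype.card Ω ∧ escapeRatio K U ≤ r

end Markov

/-! Restriction to the original vertices. -/

namespace CombMap

variable {D : Type}

/-- Every face of `M` has vertices in both blocks of `P`. -/
def AllFacesMixed (M : CombMap D) (P : ConnPartition M.graph) : Prop :=
  ∀ f : M.Face, (∃ x, M.face x = f ∧ M.origin x ∈ P.block) ∧
    ∃ x, M.face x = f ∧ M.origin x ∉ P.block

/-- The connected partitions of `T_d(M)` that restrict to `P` on the original vertices. -/
def restrictionFiber (M : CombMap D) (d : ℕ) (P : ConnPartition M.graph) :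
    Set (ConnPartition (M.refineFaces d).graph) :=
  {Q | ∀ x, M.originalVertex d x ∈ Q.block ↔ M.origin x ∈ P.block}

end CombMap

/-!
The graph `T_d(K_4)` consists of `K_4` and, inside each of its four faces, of `d` nested triangles
around a central vertex, with a ring of six triangular faces between consecutive nested triangles.
`levelVertex d x j` is the vertex at level `j` of the face of the dart `x`: level `0` is the face
of `K_4` itself, level `d + 1` its centre. Distinct vertices of a face at the same level are
adjacent, and the vertices for two different darts of the face at levels `j` and `j + 1` are
adjacent, where the centre is the vertex at level `d + 1` for each of the three darts
(`adj_level_of_ne`, `adj_level_succ_of_ne`, and conversely `exists_level_of_adj`). The orbits of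
the rotation are identified by an explicit invariant (`levelVertex_eq_iff`); it gives `12 d + 8`
vertices, Euler's formula, simplicity and the bound on the degrees. A triangulation is maximal
planar by the usual count: in any planar embedding of a larger graph all faces have at least three
sides, which leaves room for at most `3 |V| - 6` edges.

Let `P` be a partition of `K_4` without unmixed faces and let `U` be the set of partitions of
`T_d(K_4)` that restrict to `P`. Each block of `P` has two vertices. A flip that leaves `U` moves
an original vertex `v` to the other block, so it unmixes the face spanned by `v` and the two
vertices of the other block. The inside of this face could not be connected to the fourth vertex
of `K_4` afterwards, hence it lies entirely in the other block (`mem_iff_of_inFace`). On the other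
hand, such an inside can be recoloured freely by mixed triangles, as long as no two consecutive
triangles are coloured alike: from a mixed triangle there are five ways to go on
(`mixedColoring_step`, `isConnSplit_recolor`). So for each original vertex the exits through it
number at most `|U| / 5 ^ d` (`ncard_exit_mul_le`), which bounds the escape ratio of `U`.

A rotation of `K_4` of order three carries `U` to a set of the same size for another mixed
partition, and the two sets remain disjoint when the order of the blocks is forgotten
(`disjoint_unorder_rotate`). Hence `U` has at most half of the states. Two disjoint bottleneck
sets also bound the mixing time: the chain is symmetric, so that from the uniform distribution on
`U` it leaves `U` with probability at most the escape ratio per step, whereas every distribution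
gives mass at most `1 / 2` to one of the two sets (`IsSymmStochastic.le_mixingTime`).
-/

/-! ### Plane triangulations are maximal planar -/

theorem Quotient.mul_card_le_card_of_le_ncard {D : Type} [Finite D] (S : Setoid D) (k : ℕ)
    (h : ∀ q : Quotient S, k ≤ {x | (Quotient.mk S x) = q}.ncard) :
    k * Nat.card (Quotient S) ≤ Nat.card D := by
  classical
  have := Fintype.ofFinite D
  have := Fintype.ofFinite (Quotient S)
  have e := Finset.card_eq_sum_card_fiberwise (s := (Finset.univ : Finset D))
    (t := (Finset.univ : Finset (Quotient S))) (f := Quotient.mk S) (fun _ _ => by simp)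
  rw [Nat.card_eq_fintype_card, Nat.card_eq_fintype_card, ← Finset.card_univ (α := D), e,
    mul_comm, ← smul_eq_mul, ← Finset.card_univ (α := Quotient S)]
  refine Finset.card_nsmul_le_sum _ _ _ fun q _ => ?_
  refine (h q).trans_eq ?_
  rw [Set.ncard_eq_toFinset_card']
  congr 1; ext x; simp

theorem Quotient.card_eq_mul_card_of_ncard_eq {D : Type} [Finite D] (S : Setoid D) (k : ℕ)
    (h : ∀ q : Quotient S, {x | (Quotient.mk S x) = q}.ncard = k) :
    Nat.card D = k * Nat.card (Quotient S) := by
  classical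
  have := Fintype.ofFinite D
  have := Fintype.ofFinite (Quotient S)
  have e := Finset.card_eq_sum_card_fiberwise (s := (Finset.univ : Finset D))
    (t := (Finset.univ : Finset (Quotient S))) (f := Quotient.mk S) (fun _ _ => by simp)
  rw [Nat.card_eq_fintype_card, Nat.card_eq_fintype_card, ← Finset.card_univ (α := D), e,
    mul_comm, ← smul_eq_mul, ← Finset.card_univ (α := Quotient S)]
  refine Finset.sum_const_nat fun q _ => ?_
  rw [← h q, Set.ncard_eq_toFinset_card']
  congr 1; ext x; simp

theorem Equiv.Perm.SameCycle.apply_eq_of_invariant {D β : Type} {p : Equiv.Perm D} {f : D → β}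
    (hf : ∀ x, f (p x) = f x) {x y : D} (h : p.SameCycle x y) : f x = f y := by
  obtain ⟨i, rfl⟩ := h
  induction i using Int.induction_on generalizing x with
  | zero => rfl
  | succ i ih => rw [zpow_add_one, Equiv.Perm.mul_apply, ← ih, hf]
  | pred i ih =>
    rw [zpow_sub_one, Equiv.Perm.mul_apply, ← ih, ← hf (p⁻¹ x)]
    simp

namespace CombMap

variable {D : Type} (M : CombMap D)

theorem origin_eq_iff {x y : D} : M.origin x = M.origin y ↔ M.σ.SameCycle x y :=
  Quotient.eq (r := Equiv.Perm.SameCycle.setoid M.σ)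

theorem face_eq_iff {x y : D} : M.face x = M.face y ↔ M.φ.SameCycle x y :=
  Quotient.eq (r := Equiv.Perm.SameCycle.setoid M.φ)

theorem origin_σ (x : D) : M.origin (M.σ x) = M.origin x :=
  M.origin_eq_iff.2 ⟨-1, by simp⟩

theorem face_φ (x : D) : M.face (M.φ x) = M.face x :=
  M.face_eq_iff.2 ⟨-1, by simp⟩

theorem origin_φ (x : D) : M.origin (M.φ x) = M.origin (M.α x) := M.origin_σ _

theorem sameCycle_α_iff {x y : D} : M.α.SameCycle x y ↔ y = x ∨ y = M.α x := by
  constructor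
  · rintro ⟨i, rfl⟩
    have h2 : M.α ^ (2 : ℤ) = 1 := by
      ext z; simp [zpow_ofNat, pow_two, M.α_invol]
    rcases Int.even_or_odd' i with ⟨c, rfl | rfl⟩
    · left; simp [zpow_mul, h2]
    · right; simp [zpow_add, zpow_mul, h2]
  · rintro (rfl | rfl)
    · exact Equiv.Perm.SameCycle.refl _ _
    · exact ⟨1, by simp⟩

/-- The orbits of `α` are pairs. -/
theorem card_darts_eq_two_mul_card_edge [Finite D] : Nat.card D = 2 * Nat.card M.Edge := by
  refine Quotient.card_eq_mul_card_of_ncard_eq _ 2 fun q => ?_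
  induction q using Quotient.inductionOn with
  | h x =>
    have : {y | Quotient.mk (Equiv.Perm.SameCycle.setoid M.α) y = Quotient.mk _ x}
        = {x, M.α x} := by
      ext y
      simp only [Set.mem_ofPred_eq, Set.mem_insert_iff, Set.mem_singleton_iff]
      rw [eq_comm, Quotient.eq (r := Equiv.Perm.SameCycle.setoid M.α)]
      exact M.sameCycle_α_iff
    rw [this, Set.ncard_pair (M.α_ne x).symm]

theorem reachable_origin_of_mem_closure {g : Equiv.Perm D}
    (hg : g ∈ Subgroup.closure {M.σ, M.α}) (x : D) :
    M.graph.Reachable (M.origin x) (M.origin (g x)) := by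
  induction hg using Subgroup.closure_induction generalizing x with
  | mem g hg =>
    rcases hg with rfl | rfl
    · rw [M.origin_σ]
    · by_cases h : M.origin x = M.origin (M.α x)
      · rw [← h]
      · exact SimpleGraph.Adj.reachable ⟨h, x, rfl, rfl⟩
  | one => rfl
  | mul g k _ _ ihg ihk => exact (ihk x).trans (ihg (k x))
  | inv g _ ih => simpa using (ih (g⁻¹ x)).symm

variable {M}

theorem IsPlane.nonempty (h : M.IsPlane) : Nonempty D := by
  by_contra hD
  rw [not_nonempty_iff] at hD
  have e := h.2
  have h1 : IsEmpty M.Face := ⟨fun f => Quotient.inductionOn f hD.elim⟩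
  have h2 : IsEmpty M.Vertex := ⟨fun f => Quotient.inductionOn f hD.elim⟩
  simp [Nat.card_of_isEmpty] at e

theorem IsPlane.connected (h : M.IsPlane) : M.graph.Connected := by
  obtain ⟨x⟩ := h.nonempty
  have : Nonempty M.Vertex := ⟨M.origin x⟩
  refine ⟨fun u v => ?_⟩
  induction u using Quotient.inductionOn with
  | h x =>
    induction v using Quotient.inductionOn with
    | h y =>
      obtain ⟨⟨g, hg⟩, e⟩ := h.1.exists_smul_eq x y
      have e' : g x = y := e
      have := M.reachable_origin_of_mem_closure hg x
      rw [e'] at this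
      exact this

/-- The darts of a map without loops and parallel edges are those of its underlying graph. -/
noncomputable def IsSimple.dartEquiv (h : M.IsSimple) : D ≃ M.graph.Dart :=
  Equiv.ofBijective
    (fun x => ⟨(M.origin x, M.origin (M.α x)), (h.1 x).symm, x, rfl, rfl⟩) <| by
    constructor
    · intro x y e
      have e' := congrArg SimpleGraph.Dart.toProd e
      exact h.2 x y (congrArg Prod.fst e') (congrArg Prod.snd e')
    · rintro ⟨⟨u, v⟩, hne, x, hu, hv⟩
      exact ⟨x, SimpleGraph.Dart.ext _ _ (Prod.ext hu hv)⟩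

theorem IsSimple.dartEquiv_fst (h : M.IsSimple) (x : D) : (h.dartEquiv x).fst = M.origin x := rfl

theorem IsSimple.dartEquiv_α (h : M.IsSimple) (x : D) :
    h.dartEquiv (M.α x) = (h.dartEquiv x).symm := by
  refine SimpleGraph.Dart.ext _ _ (Prod.ext rfl ?_)
  change M.origin (M.α (M.α x)) = M.origin x
  rw [M.α_invol]

/-- A relabelling of the darts. -/
def relabel {E : Type} (M : CombMap D) (e : D ≃ E) : CombMap E where
  σ := e.permCongr M.σ
  α := e.permCongr M.α
  α_invol x := by simp [Equiv.permCongr_apply, M.α_invol]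
  α_ne x h := M.α_ne (e.symm x) (by
    rw [Equiv.permCongr_apply] at h
    exact e.injective (by rw [h, e.apply_symm_apply]))

theorem _root_.Equiv.Perm.sameCycle_permCongr_iff {E : Type} (e : D ≃ E) (f : Equiv.Perm D)
    {x y : E} : (e.permCongr f).SameCycle x y ↔ f.SameCycle (e.symm x) (e.symm y) := by
  have hz (i : ℤ) : (e.permCongr f) ^ i = e.permCongr (f ^ i) :=
    (map_zpow e.permCongrHom f i).symm
  simp only [Equiv.Perm.SameCycle, hz, Equiv.permCongr_apply, Equiv.eq_symm_apply]

theorem relabel_φ {E : Type} (e : D ≃ E) : (M.relabel e).φ = e.permCongr M.φ := by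
  ext x; simp [φ, relabel, Equiv.permCongr_apply]

theorem card_face_relabel {E : Type} (e : D ≃ E) :
    Nat.card (M.relabel e).Face = Nat.card M.Face := by
  refine (Nat.card_congr (Quotient.congr e fun x y => ?_)).symm
  change M.φ.SameCycle x y ↔ (M.relabel e).φ.SameCycle (e x) (e y)
  rw [relabel_φ, Equiv.Perm.sameCycle_permCongr_iff]
  simp

theorem IsSimple.exists_adj (h : M.IsSimple) (v : M.Vertex) : ∃ w, M.graph.Adj v w := by
  induction v using Quotient.inductionOn with
  | h x => exact ⟨M.origin (M.α x), (h.1 x).symm, x, rfl, rfl⟩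

theorem IsSimple.card_edgeSet [Finite D] (h : M.IsSimple) :
    Nat.card M.graph.edgeSet = Nat.card M.Edge := by
  classical
  have := Fintype.ofFinite M.Vertex
  have e := M.card_darts_eq_two_mul_card_edge
  rw [Nat.card_congr h.dartEquiv, Nat.card_eq_fintype_card,
    SimpleGraph.dart_card_eq_twice_card_edges] at e
  rw [Nat.card_eq_fintype_card, ← SimpleGraph.edgeFinset_card]
  omega

theorem isPlanarGraph_of_isPlane [Finite D] (h : M.IsPlane) (hs : M.IsSimple) :
    IsPlanarGraph M.graph := by
  refine ⟨M.relabel hs.dartEquiv, fun x => ?_, fun x y => ?_, ?_⟩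
  · change hs.dartEquiv (M.α (hs.dartEquiv.symm x)) = _
    rw [hs.dartEquiv_α, Equiv.apply_symm_apply]
  · rw [origin_eq_iff]
    change (hs.dartEquiv.permCongr M.σ).SameCycle x y ↔ _
    rw [Equiv.Perm.sameCycle_permCongr_iff, ← origin_eq_iff, ← hs.dartEquiv_fst,
      ← hs.dartEquiv_fst, Equiv.apply_symm_apply, Equiv.apply_symm_apply]
  · have h0 : {v | ∀ w, ¬ M.graph.Adj v w} = ∅ := by
      ext v
      obtain ⟨w, hw⟩ := hs.exists_adj v
      simpa using ⟨w, hw⟩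
    have hc : Nat.card M.graph.ConnectedComponent = 1 := by
      have := h.connected
      have := h.connected.preconnected.subsingleton_connectedComponent
      have : Nonempty M.graph.ConnectedComponent :=
        ⟨M.graph.connectedComponentMk (M.origin h.nonempty.some)⟩
      exact Nat.card_of_subsingleton (Classical.arbitrary _)
    rw [h0, hc, card_face_relabel, hs.card_edgeSet, Set.ncard_empty]
    have := h.2
    omega

end CombMap

/-- In a planar embedding of a connected graph with minimum degree at least two, every face has
at least three sides; so Euler's formula bounds the number of edges. -/
theorem IsPlanarGraph.card_edgeSet_add_six_le {V : Type} [Finite V] {G : SimpleGraph V}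
    (h : IsPlanarGraph G) (hc : G.Connected)
    (hdeg : ∀ v w, ∃ w', w' ≠ w ∧ G.Adj v w') :
    Nat.card G.edgeSet + 6 ≤ 3 * Nat.card V := by
  classical
  have := Fintype.ofFinite V
  obtain ⟨M, hα, ho, he⟩ := h
  have h0 : {v | ∀ w, ¬ G.Adj v w} = ∅ := by
    ext v
    obtain ⟨w, -, hw⟩ := hdeg v v
    simpa using ⟨w, hw⟩
  have hcc : Nat.card G.ConnectedComponent = 1 := by
    have := hc.preconnected.subsingleton_connectedComponent
    have : Nonempty G.ConnectedComponent := ⟨G.connectedComponentMk hc.nonempty.some⟩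
    exact Nat.card_of_subsingleton (Classical.arbitrary _)
  rw [h0, hcc, Set.ncard_empty] at he
  have hφ (x : G.Dart) : (M.φ x).fst = x.snd := by
    have := (ho _ _).1 (M.origin_φ x)
    rw [this, hα]; rfl
  have hne (x : G.Dart) : M.φ x ≠ x := fun h => x.adj.ne (by rw [← hφ x, h])
  have hne2 (x : G.Dart) : M.φ (M.φ x) ≠ x := by
    intro h2
    -- A face with two sides would be bounded by a dart and its reverse, so that the end of the
    -- dart has a single neighbour.
    have e1 : M.φ x = M.α x := by
      rw [hα]
      ext
      · exact hφ x
      · have := hφ (M.φ x)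
        rw [h2] at this
        exact this.symm
    have e2 : M.σ (M.α x) = M.α x := e1
    obtain ⟨w', hw', ha⟩ := hdeg x.snd x.fst
    have hs : M.origin (M.α x) = M.origin ⟨(x.snd, w'), ha⟩ := (ho _ _).2 (by rw [hα]; rfl)
    have hs := M.origin_eq_iff.1 hs
    have : (M.α x) = ⟨(x.snd, w'), ha⟩ := by
      obtain ⟨i, hi⟩ := hs
      rw [← hi]
      exact (Equiv.Perm.zpow_apply_eq_self_of_apply_eq_self e2 i).symm
    rw [hα] at this
    exact hw' (congrArg (fun y : G.Dart => y.snd) this).symm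
  have hF : 3 * Nat.card M.Face ≤ Nat.card G.Dart := by
    refine Quotient.mul_card_le_card_of_le_ncard _ 3 fun q => ?_
    induction q using Quotient.inductionOn with
    | h x =>
      have hsub : ({x, M.φ x, M.φ (M.φ x)} : Set G.Dart) ⊆
          {y | Quotient.mk (Equiv.Perm.SameCycle.setoid M.φ) y = Quotient.mk _ x} := by
        rintro y (rfl | rfl | rfl)
        · rfl
        · exact M.face_φ x
        · exact (M.face_φ _).trans (M.face_φ x)
      have := Set.ncard_le_ncard hsub (Set.toFinite _)
      rwa [Set.ncard_eq_three.2 ⟨x, M.φ x, M.φ (M.φ x), (hne x).symm, (hne2 x).symm,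
        (hne _).symm, rfl⟩] at this
  rw [Nat.card_eq_fintype_card (α := G.Dart), SimpleGraph.dart_card_eq_twice_card_edges,
    SimpleGraph.edgeFinset_card, ← Nat.card_eq_fintype_card] at hF
  omega

theorem CombMap.IsTriangulation.isMaximalPlanar {D : Type} [Finite D] {M : CombMap D}
    (h : M.IsTriangulation) : IsMaximalPlanar M.graph := by
  classical
  obtain ⟨hp, hs, hf⟩ := h
  refine ⟨isPlanarGraph_of_isPlane hp hs, fun G' hG hpl => ?_⟩
  have := Fintype.ofFinite M.Vertex
  have hφ3 (x : D) : M.φ (M.φ x) ≠ x := by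
    intro h2
    have hsub : {y | M.face y = M.face x} ⊆ {x, M.φ x} := by
      intro y hy
      obtain ⟨i, hi⟩ := M.face_eq_iff.1 (Eq.symm hy)
      have e2 : (M.φ ^ (2 : ℤ)) x = x := by simpa [zpow_ofNat, pow_two] using h2
      rcases Int.even_or_odd' i with ⟨c, rfl | rfl⟩
      · left
        rw [← hi, zpow_mul, Equiv.Perm.zpow_apply_eq_self_of_apply_eq_self e2]
      · right
        rw [← hi, add_comm, zpow_add, zpow_one, zpow_mul, Equiv.Perm.mul_apply,
          Equiv.Perm.zpow_apply_eq_self_of_apply_eq_self e2]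
        rfl
    have := Set.ncard_le_ncard hsub (Set.toFinite _)
    rw [hf] at this
    have := this.trans (Set.ncard_insert_le _ _)
    simp at this
  have hφ1 (x : D) : M.φ x ≠ x := fun e => hs.1 x (by rw [← M.origin_φ, e])
  have hcyc (x : D) : M.φ (M.φ (M.φ x)) = x := by
    have hsub : ({x, M.φ x, M.φ (M.φ x)} : Set D) ⊆ {y | M.face y = M.face x} := by
      rintro y (rfl | rfl | rfl)
      · rfl
      · exact M.face_φ x
      · exact (M.face_φ _).trans (M.face_φ x)
    have heq := Set.eq_of_subset_of_ncard_le hsub (by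
      rw [hf, Set.ncard_eq_three.2 ⟨x, M.φ x, M.φ (M.φ x), (hφ1 x).symm, (hφ3 x).symm,
        (hφ1 _).symm, rfl⟩]) (Set.toFinite _)
    have hmem : M.φ (M.φ (M.φ x)) ∈ ({x, M.φ x, M.φ (M.φ x)} : Set D) := by
      rw [heq]
      exact ((M.face_φ _).trans (M.face_φ _)).trans (M.face_φ x)
    rcases hmem with e | e | e
    · exact e
    · exact absurd (M.φ.injective e) (hφ3 x)
    · exact absurd e (hφ1 _)
  have hdeg (v w : M.Vertex) : ∃ w', w' ≠ w ∧ M.graph.Adj v w' := by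
    induction v using Quotient.inductionOn with
    | h x =>
      -- The two other corners of a triangle at the vertex are distinct neighbours.
      have key : M.origin (M.α x) ≠ M.origin (M.α (M.σ x)) := by
        intro e
        have := hs.2 x (M.σ x) (M.origin_σ x).symm e
        have hx : M.φ (M.α x) = x := by
          change M.σ (M.α (M.α x)) = x
          rw [M.α_invol]; exact this.symm
        have h2 : M.φ (M.φ x) = M.α x := M.φ.injective (by rw [hcyc, hx])
        exact hs.1 (M.φ x) (by rw [← M.origin_φ, h2, M.origin_φ])
      by_cases hw : M.origin (M.α x) = w
      · refine ⟨M.origin (M.α (M.σ x)), fun e => key (by rw [hw, e]), ?_, M.σ x, ?_, rfl⟩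
        · have := (hs.1 (M.σ x)).symm
          rwa [M.origin_σ] at this
        · rw [M.origin_σ]; rfl
      · exact ⟨M.origin (M.α x), hw, (hs.1 x).symm, x, rfl, rfl⟩
  have hb := hpl.card_edgeSet_add_six_le (hp.connected.mono hG.le) fun v w => by
    obtain ⟨w', h1, h2⟩ := hdeg v w
    exact ⟨w', h1, hG.le h2⟩
  have hF : Nat.card D = 3 * Nat.card M.Face := Quotient.card_eq_mul_card_of_ncard_eq _ 3 hf
  have hE := M.card_darts_eq_two_mul_card_edge
  have hlt : Nat.card M.graph.edgeSet < Nat.card G'.edgeSet := by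
    have : M.graph.edgeSet ⊂ G'.edgeSet := SimpleGraph.edgeSet_ssubset_edgeSet.2 hG
    exact Set.ncard_lt_ncard this (Set.toFinite _)
  rw [hs.card_edgeSet] at hlt
  have := hp.2
  omega

/-! ### Bottlenecks and mixing times of symmetric chains -/

section Markov

variable {Ω : Type} [Fintype Ω]

/-- A symmetric transition matrix. -/
structure IsSymmStochastic (K : Matrix Ω Ω ℝ) : Prop where
  nonneg : ∀ x y, 0 ≤ K x y
  symm : ∀ x y, K x y = K y x
  sum_row : ∀ x, ∑ y, K x y = 1

theorem IsSymmStochastic.isStationaryDist_uniformDist [Nonempty Ω] {K : Matrix Ω Ω ℝ}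
    (h : IsSymmStochastic K) : IsStationaryDist K (uniformDist Ω) := by
  refine ⟨fun x => by unfold uniformDist; positivity, ?_, ?_⟩
  · have : (Fintype.card Ω : ℝ) ≠ 0 := by exact_mod_cast Fintype.card_ne_zero
    simp [uniformDist, this]
  · ext y
    simp only [Matrix.vecMul, dotProduct, uniformDist]
    rw [← Finset.mul_sum]
    simp only [fun x => h.symm x y, h.sum_row, mul_one]

variable [DecidableEq Ω]

theorem IsSymmStochastic.pow_nonneg {K : Matrix Ω Ω ℝ} (h : IsSymmStochastic K) (t : ℕ) (x y : Ω) :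
    0 ≤ (K ^ t) x y := by
  induction t generalizing y with
  | zero => rw [pow_zero, Matrix.one_apply]; split_ifs <;> norm_num
  | succ t ih =>
    rw [pow_succ, Matrix.mul_apply]
    exact Finset.sum_nonneg fun z _ => mul_nonneg (ih z) (h.nonneg z y)

theorem IsSymmStochastic.pow_sum_row {K : Matrix Ω Ω ℝ} (h : IsSymmStochastic K) (t : ℕ) (x : Ω) :
    ∑ y, (K ^ t) x y = 1 := by
  induction t with
  | zero => simp [Matrix.one_apply]
  | succ t ih =>
    simp only [pow_succ, Matrix.mul_apply]
    rw [Finset.sum_comm]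
    simp only [← Finset.mul_sum, h.sum_row, mul_one, ih]

theorem IsSymmStochastic.pow_sum_col {K : Matrix Ω Ω ℝ} (h : IsSymmStochastic K) (t : ℕ) (y : Ω) :
    ∑ x, (K ^ t) x y = 1 := by
  induction t generalizing y with
  | zero => simp [Matrix.one_apply]
  | succ t ih =>
    simp only [pow_succ, Matrix.mul_apply]
    rw [Finset.sum_comm]
    simp only [← Finset.sum_mul, ih, one_mul, fun x => h.symm x y, h.sum_row]

open Classical in
/-- Started from the uniform distribution on `U`, a symmetric chain has, at each time, mass at most
`1 / |U|` at each state; so each step carries at most `escapeRatio K U` out of `U`. -/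
theorem IsSymmStochastic.sum_escape_le {K : Matrix Ω Ω ℝ} (h : IsSymmStochastic K) (U : Set Ω)
    (t : ℕ) :
    ∑ x, ∑ y, (if x ∈ U ∧ y ∉ U then (K ^ t) x y else 0) ≤
      t * ∑ x, ∑ y, (if x ∈ U ∧ y ∉ U then K x y else 0) := by
  induction t with
  | zero =>
    simp only [pow_zero, Nat.cast_zero, zero_mul]
    refine le_of_eq (Finset.sum_eq_zero fun x _ => Finset.sum_eq_zero fun y _ => ?_)
    split_ifs with hxy
    · exact Matrix.one_apply_ne fun e => hxy.2 (e ▸ hxy.1)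
    · rfl
  | succ t ih =>
    -- Split the last step according to whether the walk is inside `U` before it.
    have key : ∀ x y, (if x ∈ U ∧ y ∉ U then (K ^ (t + 1)) x y else 0) ≤
        ∑ z, (if x ∈ U ∧ z ∉ U then (K ^ t) x z * K z y else 0) +
        ∑ z, (if z ∈ U ∧ y ∉ U then (K ^ t) x z * K z y else 0) := by
      intro x y
      rw [← Finset.sum_add_distrib, pow_succ, Matrix.mul_apply]
      split_ifs with hxy
      · refine Finset.sum_le_sum fun z _ => ?_
        have := mul_nonneg (h.pow_nonneg t x z) (h.nonneg z y)
        by_cases hz : z ∈ U <;> simp [hz, hxy.1, hxy.2]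
      · refine Finset.sum_nonneg fun z _ => ?_
        have := mul_nonneg (h.pow_nonneg t x z) (h.nonneg z y)
        split_ifs <;> linarith
    calc ∑ x, ∑ y, (if x ∈ U ∧ y ∉ U then (K ^ (t + 1)) x y else 0)
        ≤ ∑ x, ∑ y, (∑ z, (if x ∈ U ∧ z ∉ U then (K ^ t) x z * K z y else 0) +
          ∑ z, (if z ∈ U ∧ y ∉ U then (K ^ t) x z * K z y else 0)) :=
          Finset.sum_le_sum fun x _ => Finset.sum_le_sum fun y _ => key x y
      _ = ∑ x, ∑ z, (if x ∈ U ∧ z ∉ U then (K ^ t) x z else 0) +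
          ∑ z, ∑ y, (if z ∈ U ∧ y ∉ U then K z y else 0) := by
          simp only [Finset.sum_add_distrib]
          congr 1
          · refine Finset.sum_congr rfl fun x _ => ?_
            rw [Finset.sum_comm]
            refine Finset.sum_congr rfl fun z _ => ?_
            split_ifs
            · rw [← Finset.mul_sum, h.sum_row, mul_one]
            · simp
          · rw [Finset.sum_comm]
            rw [Finset.sum_comm (f := fun z y => if z ∈ U ∧ y ∉ U then K z y else 0)]
            refine Finset.sum_congr rfl fun y _ => ?_
            rw [Finset.sum_comm]
            refine Finset.sum_congr rfl fun z _ => ?_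
            split_ifs
            · rw [← Finset.sum_mul, h.pow_sum_col, one_mul]
            · simp
      _ ≤ _ := by push_cast; linarith

/-- Some state of a bottleneck set is still likely to be in it at time `t`. -/
theorem IsSymmStochastic.exists_le_sum_pow {K : Matrix Ω Ω ℝ} (h : IsSymmStochastic K)
    {U : Finset Ω} (hU : U.Nonempty) {r : ℝ} (hr : escapeRatio K (U : Set Ω) ≤ r) (t : ℕ) :
    ∃ x ∈ U, 1 - t * r ≤ ∑ y ∈ U, (K ^ t) x y := by
  have hcard : (0 : ℝ) < U.card := by exact_mod_cast hU.card_pos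
  have hesc := h.sum_escape_le (U : Set Ω) t
  rw [escapeRatio, Set.ncard_coe_finset, div_le_iff₀ hcard] at hr
  have h2 : ∑ x ∈ U, ∑ y, (if y ∉ U then (K ^ t) x y else 0) ≤ ∑ x ∈ U, t * r := by
    rw [Finset.sum_const, nsmul_eq_mul]
    calc _ = ∑ x, ∑ y, (if x ∈ (U : Set Ω) ∧ y ∉ (U : Set Ω) then (K ^ t) x y else 0) := by
          rw [← Finset.sum_filter_add_sum_filter_not Finset.univ (· ∈ U)]
          rw [Finset.filter_mem_eq_inter, Finset.univ_inter, eq_comm,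
            Finset.sum_eq_zero (s := Finset.univ.filter (· ∉ U)), add_zero]
          · refine Finset.sum_congr rfl fun x hx => ?_
            simp [hx]
          · intro x hx
            simp [(Finset.mem_filter.1 hx).2]
      _ ≤ t * (r * U.card) :=
          le_of_eq_of_le (by congr!) (hesc.trans (mul_le_mul_of_nonneg_left hr (Nat.cast_nonneg _)))
      _ = _ := by ring
  obtain ⟨x, hx, hle⟩ := Finset.exists_le_of_sum_le hU h2
  refine ⟨x, hx, ?_⟩
  have h1 := h.pow_sum_row t x
  have : ∑ y, (K ^ t) x y = ∑ y ∈ U, (K ^ t) x y + ∑ y, (if y ∉ U then (K ^ t) x y else 0) := by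
    rw [← Finset.sum_filter, ← Finset.sum_filter_add_sum_filter_not Finset.univ (· ∈ U),
      Finset.filter_mem_eq_inter, Finset.univ_inter]
  linarith

theorem sum_sub_sum_le_tvDist {μ ν : Ω → ℝ} (h : ∑ x, μ x = ∑ x, ν x) (U : Finset Ω) :
    ∑ x ∈ U, μ x - ∑ x ∈ U, ν x ≤ tvDist μ ν := by
  have e1 := Finset.sum_add_sum_compl U μ
  have e2 := Finset.sum_add_sum_compl U ν
  have e3 := Finset.sum_add_sum_compl U fun x => |μ x - ν x|
  have h1 : ∑ x ∈ U, (μ x - ν x) ≤ ∑ x ∈ U, |μ x - ν x| :=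
    Finset.sum_le_sum fun x _ => le_abs_self _
  have h2 : -∑ x ∈ Uᶜ, (μ x - ν x) ≤ ∑ x ∈ Uᶜ, |μ x - ν x| := by
    rw [← Finset.sum_neg_distrib]
    exact Finset.sum_le_sum fun x _ => neg_le_abs _
  rw [Finset.sum_sub_distrib] at h1 h2
  unfold tvDist
  linarith

theorem tvDist_le_worstDist (K : Matrix Ω Ω ℝ) (μ : Ω → ℝ) (t : ℕ) (x : Ω) :
    tvDist ((K ^ t) x) μ ≤ worstDist K μ t :=
  le_ciSup (f := fun x => tvDist ((K ^ t) x) μ) (Set.finite_range _).bddAbove x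

/-- Every distribution gives mass at most `1 / 2` to one of two disjoint bottleneck sets, so it is
far from the distribution of the chain started in that set. -/
theorem IsSymmStochastic.le_mixingTime {K : Matrix Ω Ω ℝ} (h : IsSymmStochastic K)
    {U W : Set Ω} (hU : U.Nonempty) (hW : W.Nonempty) (hUW : Disjoint U W) {r : ℝ}
    (hrU : escapeRatio K U ≤ r) (hrW : escapeRatio K W ≤ r)
    {μ : Ω → ℝ} (hμ : IsStationaryDist K μ) (t : ℕ) (ht : worstDist K μ t ≤ 1 / 4) :
    1 / 4 ≤ t * r := by
  classical
  lift U to Finset Ω using Set.toFinite U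
  lift W to Finset Ω using Set.toFinite W
  have hsum : ∑ x ∈ U, μ x + ∑ x ∈ W, μ x ≤ 1 := by
    rw [← hμ.2.1, ← Finset.sum_union (Finset.disjoint_coe.1 hUW)]
    exact Finset.sum_le_sum_of_subset_of_nonneg (Finset.subset_univ _) fun x _ _ => hμ.1 x
  have key (S : Finset Ω) (hS : S.Nonempty) (hr : escapeRatio K (S : Set Ω) ≤ r)
      (hm : ∑ x ∈ S, μ x ≤ 1 / 2) : 1 / 4 ≤ t * r := by
    obtain ⟨x, -, hx⟩ := h.exists_le_sum_pow hS hr t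
    have h1 := sum_sub_sum_le_tvDist (μ := (K ^ t) x) (ν := μ)
      (by rw [h.pow_sum_row, hμ.2.1]) S
    have h2 := (tvDist_le_worstDist K μ t x).trans ht
    linarith
  by_cases hm : ∑ x ∈ U, μ x ≤ 1 / 2
  · exact key U (by simpa using hU) hrU hm
  · exact key W (by simpa using hW) hrW (by linarith)

end Markov

/-! ### The flip walks are symmetric -/

section Flip

variable {V : Type} {G : SimpleGraph V}

namespace ConnPartition

theorem flip_flip (P : ConnPartition G) (x : V) : (P.flip x).flip x = P := by
  by_cases h : IsConnSplit G (P.block ∆ {x})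
  · have e : P.flip x = ⟨P.block ∆ {x}, h⟩ := dif_pos h
    have e2 : (P.block ∆ {x}) ∆ {x} = P.block := by
      rw [symmDiff_assoc, symmDiff_self]; exact symmDiff_bot _
    rw [e, flip, dif_pos (by rw [e2]; exact P.conn)]
    exact ConnPartition.ext e2
  · have e : P.flip x = P := dif_neg h
    rw [e, e]

theorem flip_eq_comm {P Q : ConnPartition G} {x : V} : P.flip x = Q ↔ Q.flip x = P :=
  ⟨fun h => h ▸ P.flip_flip x, fun h => h ▸ Q.flip_flip x⟩

theorem unorder_eq_iff {P Q : ConnPartition G} : P.unorder = Q.unorder ↔ P = Q ∨ P = Q.swap :=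
  Quotient.eq (r := swapSetoid G)

theorem unorder_flip_eq_comm {P Q : ConnPartition G} {x : V} :
    (P.flip x).unorder = Q.unorder ↔ (Q.flip x).unorder = P.unorder := by
  rw [unorder_eq_iff, unorder_eq_iff, flip_eq_comm, flip_eq_comm (Q := Q.swap), swap_flip]
  refine or_congr_right ⟨fun h => ?_, fun h => ?_⟩
  · rw [← h, swap_swap]
  · rw [h, swap_swap]

theorem exists_unorder_eq (p : UnorderedConnPartition G) : ∃ P : ConnPartition G, P.unorder = p :=
  Quotient.exists_rep p

end ConnPartition

theorem sum_ncard_fiber_div {V Ω : Type} [Finite V] [Nonempty V] [Fintype Ω] (f : V → Ω) :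
    ∑ q, ({x | f x = q}.ncard / Nat.card V : ℝ) = 1 := by
  classical
  have := Fintype.ofFinite V
  rw [← Finset.sum_div, div_eq_one_iff_eq (by
    rw [Nat.card_eq_fintype_card]; exact_mod_cast Fintype.card_ne_zero)]
  rw [Nat.card_eq_fintype_card, ← Finset.card_univ,
    Finset.card_eq_sum_card_fiberwise (t := Finset.univ) (f := f) (fun _ _ => by simp)]
  push_cast
  refine Finset.sum_congr rfl fun q _ => ?_
  rw [Set.ncard_eq_toFinset_card']
  congr 2; ext x; simp

theorem isSymmStochastic_flipWalk [Finite V] [Nonempty V] (G : SimpleGraph V) :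
    IsSymmStochastic (flipWalk G) where
  nonneg P Q := by
    simp only [flipWalk, Matrix.of_apply]
    split_ifs <;> positivity
  symm P Q := by
    simp only [flipWalk, Matrix.of_apply, ConnPartition.flip_eq_comm (P := P), eq_comm (a := P)]
  sum_row P := by
    simp only [flipWalk, Matrix.of_apply, Finset.sum_add_distrib, ← Finset.mul_sum]
    rw [sum_ncard_fiber_div]
    simp; norm_num

theorem unorderedFlipWalk_apply [Finite V] (P : ConnPartition G) (q : UnorderedConnPartition G) :
    unorderedFlipWalk G P.unorder q = (1 / 2) * (if P.unorder = q then 1 else 0) +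
          (1 / 2) * ({x | (P.flip x).unorder = q}.ncard / Nat.card V : ℝ) := rfl

theorem isSymmStochastic_unorderedFlipWalk [Finite V] [Nonempty V] (G : SimpleGraph V) :
    IsSymmStochastic (unorderedFlipWalk G) where
  nonneg p q := by
    obtain ⟨P, rfl⟩ := ConnPartition.exists_unorder_eq p
    rw [unorderedFlipWalk_apply]
    split_ifs <;> positivity
  symm p q := by
    obtain ⟨P, rfl⟩ := ConnPartition.exists_unorder_eq p
    obtain ⟨Q, rfl⟩ := ConnPartition.exists_unorder_eq q
    rw [unorderedFlipWalk_apply, unorderedFlipWalk_apply]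
    simp only [ConnPartition.unorder_flip_eq_comm (P := P), eq_comm (a := P.unorder)]
  sum_row p := by
    obtain ⟨P, rfl⟩ := ConnPartition.exists_unorder_eq p
    simp only [unorderedFlipWalk_apply, Finset.sum_add_distrib, ← Finset.mul_sum]
    rw [sum_ncard_fiber_div fun x => (P.flip x).unorder]
    simp; norm_num

theorem sum_ite_ncard_fiber {V Ω : Type} [Finite V] [Fintype Ω] (f : V → Ω) (p : Ω → Prop)
    [DecidablePred p] :
    ∑ q, (if p q then ({x | f x = q}.ncard : ℝ) else 0) = {x | p (f x)}.ncard := by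
  classical
  have := Fintype.ofFinite V
  rw [Set.ncard_eq_toFinset_card',
    Finset.card_eq_sum_card_fiberwise (t := Finset.univ) (f := f) (fun _ _ => by simp)]
  push_cast
  refine Finset.sum_congr rfl fun q _ => ?_
  split_ifs with hq
  · rw [Set.ncard_eq_toFinset_card']
    congr 2; ext x; simp; rintro rfl; exact hq
  · symm
    rw [Nat.cast_eq_zero, Finset.card_eq_zero, Finset.filter_eq_empty_iff]
    intro x hx e
    simp at hx
    exact hq (e ▸ hx)

/-- The flow out of a state of `U` counts the vertices whose flip leads out of `U`. -/
theorem sum_flipWalk_escape [Finite V] (U : Set (ConnPartition G)) [DecidablePred (· ∈ U)]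
    {P : ConnPartition G} (hP : P ∈ U) :
    ∑ Q, (if P ∈ U ∧ Q ∉ U then flipWalk G P Q else 0) =
      (1 / 2) * ({x | P.flip x ∉ U}.ncard / Nat.card V : ℝ) := by
  rw [← sum_ite_ncard_fiber P.flip (· ∉ U), Finset.sum_div, Finset.mul_sum]
  refine Finset.sum_congr rfl fun Q _ => ?_
  by_cases hQ : Q ∈ U
  · simp [hQ]
  · have : P ≠ Q := fun e => hQ (e ▸ hP)
    simp [hQ, hP, flipWalk, this]

theorem sum_unorderedFlipWalk_escape [Finite V] (U : Set (UnorderedConnPartition G))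
    [DecidablePred (· ∈ U)] {P : ConnPartition G} (hP : P.unorder ∈ U) :
    ∑ q, (if P.unorder ∈ U ∧ q ∉ U then unorderedFlipWalk G P.unorder q else 0) =
      (1 / 2) * ({x | (P.flip x).unorder ∉ U}.ncard / Nat.card V : ℝ) := by
  rw [← sum_ite_ncard_fiber (fun x => (P.flip x).unorder) (· ∉ U), Finset.sum_div,
    Finset.mul_sum]
  refine Finset.sum_congr rfl fun q _ => ?_
  by_cases hQ : q ∈ U
  · simp [hQ]
  · have : P.unorder ≠ q := fun e => hQ (e ▸ hP)
    simp [hQ, hP, unorderedFlipWalk_apply, this]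

theorem escapeRatio_flipWalk_le [Finite V] [Nonempty V] {U : Set (ConnPartition G)}
    (hU : U.Nonempty) (S : Finset V) {N : ℕ} (hN : 0 < N)
    (hS : ∀ P ∈ U, ∀ x, P.flip x ∉ U → x ∈ S)
    (h : ∀ x ∈ S, {P | P ∈ U ∧ P.flip x ∉ U}.ncard * N ≤ U.ncard) :
    escapeRatio (flipWalk G) U ≤ S.card / (2 * Nat.card V * N) := by
  classical
  have hn : (0 : ℝ) < Nat.card V := by exact_mod_cast Nat.card_pos
  have hc : (0 : ℝ) < U.ncard := by exact_mod_cast (Set.ncard_pos (Set.toFinite _)).2 hU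
  have hN' : (0 : ℝ) < N := by exact_mod_cast hN
  have h2 : ∑ P, ∑ Q, (if P ∈ U ∧ Q ∉ U then flipWalk G P Q else 0) =
      ∑ P ∈ U.toFinset, (1 / 2) * ({x | P.flip x ∉ U}.ncard / Nat.card V : ℝ) := by
    rw [← Finset.sum_subset (Finset.subset_univ U.toFinset)]
    · exact Finset.sum_congr rfl fun P hP => sum_flipWalk_escape U (by simpa using hP)
    · intro P _ hP
      have : P ∉ U := by simpa using hP
      simp [this]
  have h3 : ∑ P ∈ U.toFinset, {x | P.flip x ∉ U}.ncard =
      ∑ x ∈ S, {P | P ∈ U ∧ P.flip x ∉ U}.ncard := by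
    have := Finset.sum_card_bipartiteAbove_eq_sum_card_bipartiteBelow
      (s := U.toFinset) (t := S) fun P x => P.flip x ∉ U
    convert this using 2 with P hP x hx
    · rw [← Set.ncard_coe_finset]
      congr 1; ext x
      simpa [Finset.bipartiteAbove] using hS P (by simpa using hP) x
    · rw [← Set.ncard_coe_finset]
      congr 1; ext P
      simp [Finset.bipartiteBelow]
  have h4 : ((∑ x ∈ S, {P | P ∈ U ∧ P.flip x ∉ U}.ncard : ℕ) : ℝ) * N ≤ S.card * U.ncard := by
    have := (Finset.sum_mul _ _ _).trans_le (Finset.sum_le_card_nsmul _ _ _ h)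
    rw [smul_eq_mul] at this
    exact_mod_cast this
  unfold escapeRatio
  rw [div_le_div_iff₀ hc (by positivity)]
  have h5 : ∑ P, ∑ Q, (if P ∈ U ∧ Q ∉ U then flipWalk G P Q else 0) =
      (∑ x ∈ S, {P | P ∈ U ∧ P.flip x ∉ U}.ncard : ℕ) / (2 * Nat.card V) := by
    rw [h2, ← h3, ← Finset.mul_sum, ← Finset.sum_div]
    push_cast
    field_simp
  calc _ = (∑ P, ∑ Q, (if P ∈ U ∧ Q ∉ U then flipWalk G P Q else 0)) *
          (2 * Nat.card V * N) := by congr!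
    _ ≤ _ := by
      rw [h5]
      field_simp
      exact h4

/-- Passing to unordered partitions identifies states, which can only close exits. -/
theorem escapeRatio_unorderedFlipWalk_le [Finite V] (U : Set (ConnPartition G))
    (hU : Set.InjOn ConnPartition.unorder U) :
    escapeRatio (unorderedFlipWalk G) (ConnPartition.unorder '' U) ≤
      escapeRatio (flipWalk G) U := by
  classical
  unfold escapeRatio
  have := Fintype.ofFinite V
  rw [hU.ncard_image]
  refine div_le_div_of_nonneg_right ?_ (Nat.cast_nonneg _)
  have h1 (K : Matrix (UnorderedConnPartition G) (UnorderedConnPartition G) ℝ) :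
      ∑ p, ∑ q, (if p ∈ ConnPartition.unorder '' U ∧ q ∉ ConnPartition.unorder '' U
        then K p q else 0) =
      ∑ P ∈ U.toFinset, ∑ q, (if P.unorder ∈ ConnPartition.unorder '' U ∧
        q ∉ ConnPartition.unorder '' U then K P.unorder q else 0) := by
    rw [← Finset.sum_image (g := ConnPartition.unorder) (s := U.toFinset)
      (f := fun p => ∑ q, (if p ∈ ConnPartition.unorder '' U ∧
        q ∉ ConnPartition.unorder '' U then K p q else 0)) (by simpa using hU)]
    symm
    refine Finset.sum_subset (Finset.subset_univ _) fun p _ hp => ?_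
    have : p ∉ ConnPartition.unorder '' U := by
      rintro ⟨P, hP, rfl⟩
      exact hp (Finset.mem_image_of_mem _ (by simpa using hP))
    simp only [this, false_and, if_false, Finset.sum_const_zero]
  have h2 : ∑ P, ∑ Q, (if P ∈ U ∧ Q ∉ U then flipWalk G P Q else 0) =
      ∑ P ∈ U.toFinset, ∑ Q, (if P ∈ U ∧ Q ∉ U then flipWalk G P Q else 0) := by
    symm
    refine Finset.sum_subset (Finset.subset_univ _) fun p _ hp => ?_
    have : p ∉ U := by simpa using hp
    simp [this]
  rw [h1, h2]
  refine Finset.sum_le_sum fun P hP => ?_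
  have hP : P ∈ U := by simpa using hP
  rw [sum_flipWalk_escape U hP, sum_unorderedFlipWalk_escape _ (Set.mem_image_of_mem _ hP)]
  have : {x | (P.flip x).unorder ∉ ConnPartition.unorder '' U}.ncard ≤
      {x | P.flip x ∉ U}.ncard :=
    Set.ncard_le_ncard (fun x hx h => hx (Set.mem_image_of_mem _ h)) (Set.toFinite _)
  gcongr

end Flip

/-! ### The levels of `T_d(K_4)` -/

/-- The darts of `K_4`. -/
abbrev TetraDart : Type := {p : Fin 4 × Fin 4 // p.1 ≠ p.2}

/-- The vertex of `K_4` opposite to the face of a dart; it names the face. (The four vertices add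
up to `2` modulo `4`.) -/
def oppVertex (x : TetraDart) : Fin 4 := 2 - x.1.1 - x.1.2 - (tetra.φ (tetra.φ x)).1.1

namespace Tetra

theorem φ_φ_φ : ∀ x : TetraDart, tetra.φ (tetra.φ (tetra.φ x)) = x := by decide

theorem φ_symm (x : TetraDart) : tetra.φ.symm x = tetra.φ (tetra.φ x) := by
  rw [Equiv.symm_apply_eq, φ_φ_φ]

theorem φ_ne : ∀ x : TetraDart, tetra.φ x ≠ x := by decide

theorem φ_φ_ne (x : TetraDart) : tetra.φ (tetra.φ x) ≠ x := fun h => by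
  have := φ_φ_φ x
  rw [h] at this
  exact φ_ne x this

theorem oppVertex_φ : ∀ x : TetraDart, oppVertex (tetra.φ x) = oppVertex x := by decide

theorem eq_or_of_oppVertex_eq : ∀ x y : TetraDart, oppVertex x = oppVertex y →
    y = x ∨ y = tetra.φ x ∨ y = tetra.φ (tetra.φ x) := by decide

theorem eq_or_of_fst_eq : ∀ x y : TetraDart, x.1.1 = y.1.1 →
    y = x ∨ y = tetra.σ x ∨ y = tetra.σ (tetra.σ x) := by decide

theorem fst_injOn_face : ∀ x y : TetraDart, oppVertex x = oppVertex y → x.1.1 = y.1.1 →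
    x = y := by decide

theorem fst_φ_α : ∀ x : TetraDart, (tetra.φ (tetra.α x)).1.1 = x.1.1 := by decide

theorem eq_of_fst_eq_of_fst_φ_eq : ∀ x y : TetraDart, x.1.1 = y.1.1 →
    (tetra.φ x).1.1 = (tetra.φ y).1.1 → x = y := by decide

theorem origin_eq_iff {x y : TetraDart} : tetra.origin x = tetra.origin y ↔ x.1.1 = y.1.1 := by
  constructor
  · intro h
    exact (tetra.origin_eq_iff.1 h).apply_eq_of_invariant (f := fun z => z.1.1) fun _ => rfl
  · intro h
    rcases eq_or_of_fst_eq x y h with rfl | rfl | rfl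
    · rfl
    · rw [tetra.origin_σ]
    · rw [tetra.origin_σ, tetra.origin_σ]

end Tetra

section Levels

variable (d : ℕ)

/-- The place of the origin of a dart of `T_d(K_4)`. The vertices of `T_d(K_4)` in a face of `K_4`,
its corners included, form `d + 2` levels `0, …, d + 1`: level `0` holds the corners, level `d + 1`
the single vertex inside the innermost triangle. At each level from `0` to `d` there is one vertex
for each of the three darts `x` of the face; at level `0` it is the corner opposite to `x`. -/
def place : CombMap.GadgetDart TetraDart d → TetraDart × ℕ
  | (x, Sum.inl k, 0) => (tetra.φ x, k)
  | (x, Sum.inl k, 1) => (tetra.φ (tetra.φ x), k)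
  | (x, Sum.inl k, 2) => (x, k + 1)
  | (x, Sum.inr k, 0) => (tetra.φ (tetra.φ x), k + 1)
  | (x, Sum.inr k, 1) => (tetra.φ x, k + 1)
  | (x, Sum.inr k, 2) => (x, k)

/-- A complete invariant of the vertex at level `j` for the dart `x`. -/
def levelKey (x : TetraDart) (j : ℕ) : ℕ × Fin 4 × Fin 4 :=
  if j = 0 then (0, (tetra.φ (tetra.φ x)).1.1, 0)
  else if j = d + 1 then (d + 1, oppVertex x, 0) else (j, x.1)

variable {d}

theorem levelKey_zero (x : TetraDart) :
    levelKey d x 0 = (0, (tetra.φ (tetra.φ x)).1.1, 0) := rfl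

theorem levelKey_last (x : TetraDart) : levelKey d x (d + 1) = (d + 1, oppVertex x, 0) := by
  simp [levelKey]

theorem levelKey_mid (x : TetraDart) {j : ℕ} (h0 : j ≠ 0) (h1 : j ≤ d) :
    levelKey d x j = (j, x.1) := by
  rw [levelKey, if_neg h0, if_neg (by omega)]

theorem levelKey_fst (x : TetraDart) (j : ℕ) : (levelKey d x j).1 = j := by
  unfold levelKey; split_ifs <;> simp_all

theorem level_eq_of_levelKey_eq {x y : TetraDart} {j k : ℕ} (h : levelKey d x j = levelKey d y k) :
    j = k := by
  rw [← levelKey_fst (d := d) x j, h, levelKey_fst]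

theorem eq_of_levelKey_eq {x y : TetraDart} {j : ℕ} (h0 : j ≠ 0) (h1 : j ≤ d)
    (h : levelKey d x j = levelKey d y j) : x = y := by
  rw [levelKey_mid x h0 h1, levelKey_mid y h0 h1] at h
  exact Subtype.ext (congrArg Prod.snd h)

theorem oppVertex_eq_of_levelKey_eq {x y : TetraDart} {j : ℕ} (h0 : j ≠ 0) (h1 : j ≤ d + 1)
    (h : levelKey d x j = levelKey d y j) : oppVertex x = oppVertex y := by
  rcases Nat.lt_or_ge d j with hj | hj
  · obtain rfl : j = d + 1 := by omega
    rw [levelKey_last, levelKey_last] at h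
    exact congrArg (fun p => p.2.1) h
  · rw [eq_of_levelKey_eq h0 hj h]

theorem levelKey_injOn_face {x y : TetraDart} {j : ℕ} (h1 : j ≤ d)
    (hf : oppVertex x = oppVertex y) (h : levelKey d x j = levelKey d y j) : x = y := by
  rcases Nat.eq_zero_or_pos j with rfl | hj
  · rw [levelKey_zero, levelKey_zero] at h
    have h2 : (tetra.φ (tetra.φ x)).1.1 = (tetra.φ (tetra.φ y)).1.1 :=
      congrArg (fun p => p.2.1) h
    have := Tetra.fst_injOn_face _ _ (by simpa only [Tetra.oppVertex_φ] using hf) h2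
    exact tetra.φ.injective (tetra.φ.injective this)
  · exact eq_of_levelKey_eq hj.ne' h1 h

/-- The invariant of the origin of a dart. -/
def dartKey (y : CombMap.GadgetDart TetraDart d) : ℕ × Fin 4 × Fin 4 :=
  levelKey d (place d y).1 (place d y).2

theorem tetraRefined_σ (y : CombMap.GadgetDart TetraDart d) :
    (tetraRefined d).σ y = ((tetra.dual.gadgetRev d y).1, (tetra.dual.gadgetRev d y).2.1,
      (tetra.dual.gadgetRev d y).2.2 + 1) := rfl

theorem tetraRefined_α (y : CombMap.GadgetDart TetraDart d) :
    (tetraRefined d).α y = tetra.dual.gadgetRev d y := rfl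

/-- The faces of `T_d(K_4)` are the nodes of the gadgets. -/
theorem tetraRefined_φ (x : TetraDart) (n : Fin (d + 1) ⊕ Fin d) (i : Fin 3) :
    (tetraRefined d).φ (x, n, i) = (x, n, i + 1) := by
  rw [CombMap.φ, Equiv.Perm.mul_apply, tetraRefined_σ, tetraRefined_α,
    tetra.dual.gadgetRev_invol d]

theorem tetra_dual_σ : tetra.dual.σ = tetra.φ := rfl

theorem tetra_dual_α : tetra.dual.α = tetra.α := rfl

section Rotation

variable (x : TetraDart)

theorem σ_inl_zero_zero : (tetraRefined d).σ (x, Sum.inl 0, 0) = (tetra.α x, Sum.inl 0, 1) := by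
  simp [tetraRefined_σ, CombMap.gadgetRev, tetra_dual_α]

theorem σ_inl_succ_zero (k : Fin d) :
    (tetraRefined d).σ (x, Sum.inl k.succ, 0) = (x, Sum.inr k, 1) := by
  simp [tetraRefined_σ, CombMap.gadgetRev]

theorem σ_inl_castSucc_one (k : Fin d) :
    (tetraRefined d).σ (x, Sum.inl k.castSucc, 1) = (tetra.φ (tetra.φ x), Sum.inr k, 2) := by
  simp [tetraRefined_σ, CombMap.gadgetRev, tetra_dual_σ, Tetra.φ_symm, Fin.castSucc_ne_last]

theorem σ_inl_last_one :
    (tetraRefined d).σ (x, Sum.inl (Fin.last d), 1) = (tetra.φ x, Sum.inl (Fin.last d), 0) := by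
  simp [tetraRefined_σ, CombMap.gadgetRev, tetra_dual_σ]

theorem σ_inl_castSucc_two (k : Fin d) :
    (tetraRefined d).σ (x, Sum.inl k.castSucc, 2) = (tetra.φ x, Sum.inr k, 0) := by
  simp [tetraRefined_σ, CombMap.gadgetRev, tetra_dual_σ, Fin.castSucc_ne_last]

theorem σ_inl_last_two : (tetraRefined d).σ (x, Sum.inl (Fin.last d), 2) =
    (tetra.φ (tetra.φ x), Sum.inl (Fin.last d), 2) := by
  simp [tetraRefined_σ, CombMap.gadgetRev, tetra_dual_σ, Tetra.φ_symm]

theorem σ_inr_zero (k : Fin d) :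
    (tetraRefined d).σ (x, Sum.inr k, 0) = (x, Sum.inl k.succ, 1) := by
  simp [tetraRefined_σ, CombMap.gadgetRev]

theorem σ_inr_one (k : Fin d) :
    (tetraRefined d).σ (x, Sum.inr k, 1) = (tetra.φ x, Sum.inl k.castSucc, 2) := by
  simp [tetraRefined_σ, CombMap.gadgetRev, tetra_dual_σ]

theorem σ_inr_two (k : Fin d) :
    (tetraRefined d).σ (x, Sum.inr k, 2) = (tetra.φ (tetra.φ x), Sum.inl k.castSucc, 0) := by
  simp [tetraRefined_σ, CombMap.gadgetRev, tetra_dual_σ, Tetra.φ_symm]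

end Rotation

theorem dartKey_σ (y : CombMap.GadgetDart TetraDart d) :
    dartKey ((tetraRefined d).σ y) = dartKey y := by
  obtain ⟨x, k | k, i⟩ := y
  · fin_cases i
    · refine Fin.cases ?_ (fun k => ?_) k
      · refine (congrArg dartKey (σ_inl_zero_zero x)).trans ?_
        simp only [dartKey, place, Fin.val_zero, levelKey_zero, Tetra.φ_φ_φ]
        rw [Tetra.fst_φ_α]
      · exact (congrArg dartKey (σ_inl_succ_zero x k)).trans rfl
    · refine Fin.lastCases ?_ (fun k => ?_) k
      · exact (congrArg dartKey (σ_inl_last_one x)).trans rfl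
      · exact (congrArg dartKey (σ_inl_castSucc_one x k)).trans rfl
    · refine Fin.lastCases ?_ (fun k => ?_) k
      · refine (congrArg dartKey (σ_inl_last_two x)).trans ?_
        simp only [dartKey, place, Fin.val_last, levelKey_last,
          Tetra.oppVertex_φ]
      · refine (congrArg dartKey (σ_inl_castSucc_two x k)).trans ?_
        simp [dartKey, place, Tetra.φ_φ_φ]
  · fin_cases i
    · exact (congrArg dartKey (σ_inr_zero x k)).trans rfl
    · exact (congrArg dartKey (σ_inr_one x k)).trans rfl
    · refine (congrArg dartKey (σ_inr_two x k)).trans ?_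
      simp [dartKey, place, Tetra.φ_φ_φ]

variable (d) in
/-- The vertex at level `j ≤ d + 1` for the dart `x`. -/
def levelVertex (x : TetraDart) : ℕ → (tetraRefined d).Vertex
  | 0 => (tetraRefined d).origin (tetra.φ (tetra.φ x), Sum.inl 0, 0)
  | j + 1 => (tetraRefined d).origin (x, Sum.inl (Fin.ofNat (d + 1) j), 2)

theorem originalVertex_eq (x : TetraDart) :
    tetra.originalVertex d x = levelVertex d (tetra.φ x) 0 := by
  simp only [levelVertex, Tetra.φ_φ_φ]; rfl

theorem levelVertex_succ (x : TetraDart) (k : Fin (d + 1)) :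
    levelVertex d x (k + 1) = (tetraRefined d).origin (x, Sum.inl k, 2) := by
  simp [levelVertex]

theorem origin_eq_levelVertex (y : CombMap.GadgetDart TetraDart d) :
    (tetraRefined d).origin y = levelVertex d (place d y).1 (place d y).2 := by
  have hσ := (tetraRefined d).origin_σ
  -- A rotation leads from each dart to the dart that represents its place.
  have h10 (x : TetraDart) (k : Fin d) : (tetraRefined d).origin (x, Sum.inl k.succ, 0) =
      (tetraRefined d).origin (tetra.φ x, Sum.inl k.castSucc, 2) := by
    rw [← hσ, σ_inl_succ_zero, ← hσ, σ_inr_one]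
  have h20 (x : TetraDart) (k : Fin d) : (tetraRefined d).origin (x, Sum.inl k.castSucc, 2) =
      (tetraRefined d).origin (tetra.φ x, Sum.inl k.succ, 1) := by
    rw [← hσ, σ_inl_castSucc_two, ← hσ, σ_inr_zero]
  have h0 (x : TetraDart) : (tetraRefined d).origin (x, Sum.inl 0, 0) =
      levelVertex d (tetra.φ x) 0 := (originalVertex_eq x)
  have hs (x : TetraDart) (k : Fin d) :
      (tetraRefined d).origin (x, Sum.inl k.castSucc, 2) = levelVertex d x (k + 1) :=
    (levelVertex_succ x k.castSucc).symm
  have hin0 (x : TetraDart) (k : Fin (d + 1)) :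
      (tetraRefined d).origin (x, Sum.inl k, 0) = levelVertex d (tetra.φ x) k := by
    refine Fin.cases ?_ (fun k => ?_) k
    · exact h0 x
    · rw [h10, hs, Fin.val_succ]
  obtain ⟨x, k | k, i⟩ := y
  · fin_cases i
    · exact hin0 x k
    · change (tetraRefined d).origin (x, Sum.inl k, 1) = levelVertex d (tetra.φ (tetra.φ x)) k
      refine Fin.lastCases ?_ (fun k => ?_) k
      · rw [← hσ, σ_inl_last_one, hin0]
      · rw [← hσ, σ_inl_castSucc_one, ← hσ, σ_inr_two, Tetra.φ_φ_φ, hin0, Fin.val_castSucc]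
    · exact (levelVertex_succ x k).symm
  · fin_cases i
    · change (tetraRefined d).origin (x, Sum.inr k, 0) =
        levelVertex d (tetra.φ (tetra.φ x)) (k + 1)
      rw [← hs, ← hσ (tetra.φ (tetra.φ x), _), σ_inl_castSucc_two, Tetra.φ_φ_φ]
    · change (tetraRefined d).origin (x, Sum.inr k, 1) = levelVertex d (tetra.φ x) (k + 1)
      rw [← hσ, σ_inr_one, hs]
    · change (tetraRefined d).origin (x, Sum.inr k, 2) = levelVertex d x k
      rw [← hσ, σ_inr_two, hin0, Tetra.φ_φ_φ, Fin.val_castSucc]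

theorem place_snd_le (y : CombMap.GadgetDart TetraDart d) : (place d y).2 ≤ d + 1 := by
  obtain ⟨x, k | k, i⟩ := y <;> fin_cases i <;> simp [place] <;> omega

theorem exists_levelVertex_eq (v : (tetraRefined d).Vertex) :
    ∃ x j, j ≤ d + 1 ∧ levelVertex d x j = v := by
  induction v using Quotient.inductionOn with
  | h y => exact ⟨_, _, place_snd_le y, (origin_eq_levelVertex y).symm⟩

variable (d) in
/-- The invariant `levelKey` as a function of the vertex. -/
def vertexKey : (tetraRefined d).Vertex → ℕ × Fin 4 × Fin 4 :=
  Quotient.lift dartKey fun _ _ h => h.apply_eq_of_invariant dartKey_σ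

theorem vertexKey_levelVertex (x : TetraDart) {j : ℕ} (hj : j ≤ d + 1) :
    vertexKey d (levelVertex d x j) = levelKey d x j := by
  cases j with
  | zero =>
    change levelKey d (tetra.φ (tetra.φ (tetra.φ x))) 0 = _
    rw [Tetra.φ_φ_φ]
  | succ j =>
    change levelKey d x ((Fin.ofNat (d + 1) j : ℕ) + 1) = _
    rw [Fin.val_ofNat, Nat.mod_eq_of_lt (by omega)]

theorem levelVertex_eq_iff {x y : TetraDart} {j k : ℕ} (hj : j ≤ d + 1) (hk : k ≤ d + 1) :
    levelVertex d x j = levelVertex d y k ↔ levelKey d x j = levelKey d y k := by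
  constructor
  · intro h
    rw [← vertexKey_levelVertex x hj, h, vertexKey_levelVertex y hk]
  · intro h
    obtain rfl := level_eq_of_levelKey_eq h
    have hσ := (tetraRefined d).origin_σ
    rcases Nat.eq_zero_or_pos j with rfl | h0
    · rw [levelKey_zero, levelKey_zero] at h
      have h1 : (tetra.φ (tetra.φ x)).1.1 = (tetra.φ (tetra.φ y)).1.1 :=
        congrArg (fun p => p.2.1) h
      have hrot (z : TetraDart) : (tetraRefined d).origin (tetra.σ z, Sum.inl 0, 0) =
          (tetraRefined d).origin (z, Sum.inl 0, 0) := by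
        rw [← hσ (z, _), σ_inl_zero_zero, origin_eq_levelVertex, origin_eq_levelVertex]
        rfl
      rcases Tetra.eq_or_of_fst_eq _ _ h1 with e | e | e <;> simp only [levelVertex, e, hrot]
    · rcases Nat.lt_or_ge d j with hd | hd
      · obtain rfl : j = d + 1 := by omega
        have hf := oppVertex_eq_of_levelKey_eq h0.ne' le_rfl h
        have hrot (z : TetraDart) :
            levelVertex d (tetra.φ (tetra.φ z)) (d + 1) = levelVertex d z (d + 1) := by
          have := levelVertex_succ z (Fin.last d)
          rw [Fin.val_last] at this
          rw [this, ← hσ, σ_inl_last_two, origin_eq_levelVertex]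
          rfl
        rcases Tetra.eq_or_of_oppVertex_eq _ _ hf with rfl | rfl | rfl
        · rfl
        · rw [← hrot (tetra.φ x), Tetra.φ_φ_φ]
        · rw [hrot]
      · rw [eq_of_levelKey_eq h0.ne' hd h]

theorem levelVertex_last_eq {x y : TetraDart} (h : oppVertex x = oppVertex y) :
    levelVertex d x (d + 1) = levelVertex d y (d + 1) := by
  rw [levelVertex_eq_iff le_rfl le_rfl, levelKey_last, levelKey_last, h]

theorem levelVertex_zero_eq_iff {x y : TetraDart} :
    levelVertex d x 0 = levelVertex d y 0 ↔
      (tetra.φ (tetra.φ x)).1.1 = (tetra.φ (tetra.φ y)).1.1 := by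
  rw [levelVertex_eq_iff (Nat.zero_le _) (Nat.zero_le _), levelKey_zero, levelKey_zero]
  simp

theorem vertexKey_injective : Function.Injective (vertexKey d) := by
  intro u v h
  obtain ⟨x, j, hj, rfl⟩ := exists_levelVertex_eq u
  obtain ⟨y, k, hk, rfl⟩ := exists_levelVertex_eq v
  rw [vertexKey_levelVertex x hj, vertexKey_levelVertex y hk] at h
  rwa [levelVertex_eq_iff hj hk]

theorem card_vertex : Nat.card (tetraRefined d).Vertex = 12 * d + 8 := by
  have hr : Set.range (vertexKey d) = ((({0} ×ˢ (Finset.univ ×ˢ {0})) ∪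
      (({d + 1} ×ˢ (Finset.univ ×ˢ {0})) ∪
      (Finset.Icc 1 d ×ˢ Finset.univ.filter fun p : Fin 4 × Fin 4 => p.1 ≠ p.2)) :
      Finset (ℕ × Fin 4 × Fin 4)) : Set (ℕ × Fin 4 × Fin 4)) := by
    ext ⟨j, p, q⟩
    simp only [Finset.coe_union, Set.mem_union, Finset.mem_coe, Finset.mem_product,
      Finset.mem_singleton, Finset.mem_univ, true_and, Finset.mem_Icc, Finset.mem_filter,
      Set.mem_range]
    constructor
    · rintro ⟨v, hv⟩
      obtain ⟨x, k, hk, rfl⟩ := exists_levelVertex_eq v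
      rw [vertexKey_levelVertex x hk] at hv
      rcases Nat.eq_zero_or_pos k with rfl | h0
      · rw [levelKey_zero] at hv
        simp only [Prod.mk.injEq] at hv
        left; exact ⟨hv.1.symm, hv.2.2.symm⟩
      · rcases Nat.lt_or_ge d k with hd | hd
        · obtain rfl : k = d + 1 := by omega
          rw [levelKey_last] at hv
          simp only [Prod.mk.injEq] at hv
          right; left; exact ⟨hv.1.symm, hv.2.2.symm⟩
        · rw [levelKey_mid x h0.ne' hd] at hv
          simp only [Prod.ext_iff] at hv
          right; right
          refine ⟨by omega, ?_⟩
          rw [← hv.2.1, ← hv.2.2]; exact x.2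
    · rintro (⟨rfl, rfl⟩ | ⟨rfl, rfl⟩ | ⟨h, hne⟩)
      · have : ∀ p : Fin 4, ∃ x : TetraDart, (tetra.φ (tetra.φ x)).1.1 = p := by decide
        obtain ⟨x, hx⟩ := this p
        exact ⟨levelVertex d x 0, by
          rw [vertexKey_levelVertex x (Nat.zero_le _), levelKey_zero, hx]⟩
      · have : ∀ p : Fin 4, ∃ x : TetraDart, oppVertex x = p := by decide
        obtain ⟨x, hx⟩ := this p
        exact ⟨levelVertex d x (d + 1), by
          rw [vertexKey_levelVertex x le_rfl, levelKey_last, hx]⟩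
      · exact ⟨levelVertex d ⟨(p, q), hne⟩ j, by
          rw [vertexKey_levelVertex _ (by omega), levelKey_mid _ (by omega) h.2]⟩
  have e : Nat.card (tetraRefined d).Vertex = (Set.range (vertexKey d)).ncard := by
    rw [← Set.image_univ, Set.ncard_image_of_injective _ vertexKey_injective, Set.ncard_univ]
  rw [e, hr, Set.ncard_coe_finset, Finset.card_union_of_disjoint, Finset.card_union_of_disjoint,
    Finset.card_product, Finset.card_product, Finset.card_product]
  · have : (Finset.univ.filter fun p : Fin 4 × Fin 4 => p.1 ≠ p.2).card = 12 := by decide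
    simp [this]; ring
  · rw [Finset.disjoint_left]
    rintro ⟨j, p, q⟩ h1 h2
    simp at h1 h2
    omega
  · rw [Finset.disjoint_left]
    rintro ⟨j, p, q⟩ h1 h2
    simp at h1 h2
    omega

end Levels

/-! ### `T_d(K_4)` is a triangulation with maximum degree at most nine -/

section Triangulation

variable {d : ℕ}

/-- The corners of a face, listed along its boundary. -/
theorem origin_α (x : TetraDart) (n : Fin (d + 1) ⊕ Fin d) (i : Fin 3) :
    (tetraRefined d).origin ((tetraRefined d).α (x, n, i)) =
      (tetraRefined d).origin (x, n, i + 1) := by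
  rw [← CombMap.origin_φ, tetraRefined_φ]

theorem dartKey_add_one_ne (x : TetraDart) (n : Fin (d + 1) ⊕ Fin d) (i : Fin 3) :
    dartKey (x, n, i + 1) ≠ dartKey (x, n, i) := by
  intro h
  obtain k | k := n
  · fin_cases i
    · have := levelKey_injOn_face (Nat.lt_succ_iff.1 k.2)
        (by simp only [place, Tetra.oppVertex_φ]) (x := (place d (x, Sum.inl k, 1)).1)
        (y := (place d (x, Sum.inl k, 0)).1) h
      exact Tetra.φ_ne _ this
    · have : (k : ℕ) + 1 = k := level_eq_of_levelKey_eq h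
      omega
    · have : (k : ℕ) = k + 1 := level_eq_of_levelKey_eq h
      omega
  · fin_cases i
    · have := levelKey_injOn_face k.2
        (by simp only [place, Tetra.oppVertex_φ]) (x := (place d (x, Sum.inr k, 1)).1)
        (y := (place d (x, Sum.inr k, 0)).1) h
      exact Tetra.φ_ne _ this.symm
    · have : (k : ℕ) = k + 1 := level_eq_of_levelKey_eq h
      omega
    · have : (k : ℕ) + 1 = k := level_eq_of_levelKey_eq h
      omega

section Corners

variable {x y : TetraDart} {k : ℕ}

theorem eq_of_levelKey_same (hk : k ≤ d) (h1 : levelKey d (tetra.φ x) k = levelKey d (tetra.φ y) k)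
    (h2 : levelKey d (tetra.φ (tetra.φ x)) k = levelKey d (tetra.φ (tetra.φ y)) k) : x = y := by
  rcases Nat.eq_zero_or_pos k with rfl | h0
  · simp only [levelKey_zero, Tetra.φ_φ_φ, Prod.mk.injEq, true_and, and_true] at h1 h2
    exact Tetra.eq_of_fst_eq_of_fst_φ_eq x y h1 h2
  · exact tetra.φ.injective (eq_of_levelKey_eq h0.ne' hk h1)

theorem levelKey_same_cross (h0 : k ≠ 0) (hk : k ≤ d)
    (h1 : levelKey d (tetra.φ (tetra.φ x)) k = levelKey d (tetra.φ y) k)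
    (h2 : levelKey d (tetra.φ x) k = levelKey d (tetra.φ (tetra.φ y)) k) : False := by
  have e1 := tetra.φ.injective (eq_of_levelKey_eq h0 hk h1)
  have e2 := tetra.φ.injective (eq_of_levelKey_eq h0 hk h2)
  rw [e2] at e1
  exact Tetra.φ_ne y (by rw [← e1, Tetra.φ_φ_φ, e1])

theorem eq_of_levelKey_up (hk : k ≤ d)
    (h1 : levelKey d (tetra.φ (tetra.φ x)) k = levelKey d (tetra.φ (tetra.φ y)) k)
    (h2 : levelKey d x (k + 1) = levelKey d y (k + 1)) : x = y := by
  have hf := oppVertex_eq_of_levelKey_eq (by omega) (by omega) h2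
  exact tetra.φ.injective (tetra.φ.injective
    (levelKey_injOn_face hk (by simpa only [Tetra.oppVertex_φ]) h1))

theorem eq_of_levelKey_down (hk : k ≤ d)
    (h1 : levelKey d (tetra.φ x) k = levelKey d (tetra.φ y) k)
    (h2 : levelKey d x (k + 1) = levelKey d y (k + 1)) : x = y := by
  have hf := oppVertex_eq_of_levelKey_eq (by omega) (by omega) h2
  exact tetra.φ.injective (levelKey_injOn_face hk (by simpa only [Tetra.oppVertex_φ]) h1)

theorem eq_of_levelKey_up' (hk : k + 1 ≤ d)
    (h2 : levelKey d (tetra.φ (tetra.φ x)) (k + 1) = levelKey d (tetra.φ (tetra.φ y)) (k + 1)) :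
    x = y :=
  tetra.φ.injective (tetra.φ.injective (eq_of_levelKey_eq (by omega) hk h2))

theorem eq_of_levelKey_down' (hk : k + 1 ≤ d)
    (h2 : levelKey d (tetra.φ x) (k + 1) = levelKey d (tetra.φ y) (k + 1)) : x = y :=
  tetra.φ.injective (eq_of_levelKey_eq (by omega) hk h2)

theorem levelKey_up_cross (hk : k + 1 ≤ d)
    (h1 : levelKey d (tetra.φ (tetra.φ x)) k = levelKey d y k)
    (h2 : levelKey d x (k + 1) = levelKey d (tetra.φ (tetra.φ y)) (k + 1)) : False := by
  have e := eq_of_levelKey_eq (by omega) hk h2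
  rw [e, Tetra.φ_φ_φ] at h1
  exact Tetra.φ_ne y (levelKey_injOn_face (by omega) (Tetra.oppVertex_φ y) h1)

theorem levelKey_down_cross (hk : k + 1 ≤ d)
    (h1 : levelKey d (tetra.φ x) k = levelKey d y k)
    (h2 : levelKey d x (k + 1) = levelKey d (tetra.φ y) (k + 1)) : False := by
  have e := eq_of_levelKey_eq (by omega) hk h2
  rw [e] at h1
  exact Tetra.φ_φ_ne y (levelKey_injOn_face (by omega) (by simp only [Tetra.oppVertex_φ]) h1)

end Corners

/-- A dart is determined by its two ends: their levels tell in which kind of gadget node the dart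
lies up to two possibilities, which are told apart by the order of the darts in a face of `K_4`. -/
theorem dart_eq_of_dartKey_eq {a b : CombMap.GadgetDart TetraDart d}
    (h1 : dartKey a = dartKey b)
    (h2 : dartKey (a.1, a.2.1, a.2.2 + 1) = dartKey (b.1, b.2.1, b.2.2 + 1)) : a = b := by
  have l1 := level_eq_of_levelKey_eq h1
  have l2 := level_eq_of_levelKey_eq h2
  obtain ⟨x, k | k, i⟩ := a <;> obtain ⟨y, l | l, j⟩ := b <;> fin_cases i <;> fin_cases j <;>
    simp [place] at l1 l2 <;> (try omega) <;> have hk := k.2 <;> have hl := l.2 <;>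
    simp [dartKey, place] at h1 h2 <;> (try simp only [l1] at h1 h2)
  · rw [eq_of_levelKey_same (by omega) h1 h2, Fin.ext l1]
  · rw [eq_of_levelKey_up (by omega) h1 h2, Fin.ext l1]
  · rw [eq_of_levelKey_down (by omega) h2 h1, Fin.ext l1]
  · exact (levelKey_same_cross (by omega) (by omega) h2 h1).elim
  · exact (levelKey_up_cross (by omega) h1 h2).elim
  · exact (levelKey_down_cross (by omega) h2 h1).elim
  · exact (levelKey_same_cross (by omega) (by omega) h1 h2).elim
  · exact (levelKey_down_cross (by omega) h2.symm h1.symm).elim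
  · exact (levelKey_up_cross (by omega) h1.symm h2.symm).elim
  · rw [eq_of_levelKey_down' (by omega) h2, Fin.ext l1]
  · rw [eq_of_levelKey_down' (by omega) h1, Fin.ext l1]
  · rw [eq_of_levelKey_up' (by omega) h2, Fin.ext l1]

theorem tetraRefined_isSimple (d : ℕ) : (tetraRefined d).IsSimple := by
  constructor
  · rintro ⟨x, n, i⟩ h
    rw [origin_α] at h
    exact dartKey_add_one_ne x n i (congrArg (vertexKey d) h)
  · rintro ⟨x, n, i⟩ ⟨y, m, j⟩ h1 h2
    rw [origin_α, origin_α] at h2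
    exact dart_eq_of_dartKey_eq (congrArg (vertexKey d) h1) (congrArg (vertexKey d) h2)

theorem tetraRefined_ncard_face (d : ℕ) (f : (tetraRefined d).Face) :
    {y | (tetraRefined d).face y = f}.ncard = 3 := by
  induction f using Quotient.inductionOn with
  | h y =>
    obtain ⟨x, n, i⟩ := y
    have hface (j : Fin 3) : (tetraRefined d).face (x, n, j + 1) =
        (tetraRefined d).face (x, n, j) := by
      rw [← tetraRefined_φ, CombMap.face_φ]
    have : {y | (tetraRefined d).face y = (tetraRefined d).face (x, n, i)} =
        (fun j : Fin 3 => (x, n, j)) '' Set.univ := by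
      ext ⟨x', n', j⟩
      simp only [Set.image_univ, Set.mem_range, Set.mem_ofPred_eq]
      constructor
      · intro h
        have := ((tetraRefined d).face_eq_iff.1 h).apply_eq_of_invariant
          (f := fun z => (z.1, z.2.1)) fun ⟨_, _, _⟩ => by rw [tetraRefined_φ]
        simp only [Prod.mk.injEq] at this
        exact ⟨j, by rw [this.1, this.2]⟩
      · rintro ⟨j', h⟩
        rw [← h]
        have h1 := hface 0
        have h2 := hface 1
        have h3 := hface 2
        fin_cases i <;> fin_cases j' <;> simp_all
    refine (congrArg Set.ncard this).trans ?_
    rw [Set.ncard_image_of_injective _ fun a b h => by simpa using h]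
    simp

theorem card_tetraDart : Nat.card TetraDart = 12 := by
  rw [Nat.card_eq_fintype_card]; decide

theorem card_gadgetDart (d : ℕ) :
    Nat.card (CombMap.GadgetDart TetraDart d) = 72 * d + 36 := by
  rw [Nat.card_prod, Nat.card_prod, Nat.card_sum, card_tetraDart]
  simp only [Nat.card_eq_fintype_card, Fintype.card_fin]
  ring

theorem eq_of_φ_α_invariant {β : Type} {f : TetraDart → β} (hφ : ∀ x, f (tetra.φ x) = f x)
    (hα : ∀ x, f (tetra.α x) = f x) (x y : TetraDart) : f x = f y := by
  have key : ∀ x y : TetraDart, ∃ i j : Fin 3, y = tetra.φ^[i] x ∨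
      y = tetra.φ^[i] (tetra.α (tetra.φ^[j] x)) := by decide
  have hit (n : ℕ) (z : TetraDart) : f (tetra.φ^[n] z) = f z := by
    induction n generalizing z with
    | zero => rfl
    | succ n ih => rw [Function.iterate_succ_apply, ih, hφ]
  obtain ⟨i, j, rfl | rfl⟩ := key x y
  · rw [hit]
  · rw [hit, hα, hit]

theorem tetraRefined_isPretransitive (d : ℕ) :
    MulAction.IsPretransitive (Subgroup.closure {(tetraRefined d).σ, (tetraRefined d).α})
      (CombMap.GadgetDart TetraDart d) := by
  set S := Subgroup.closure {(tetraRefined d).σ, (tetraRefined d).α} with hS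
  let q : CombMap.GadgetDart TetraDart d →
      Quotient (MulAction.orbitRel S (CombMap.GadgetDart TetraDart d)) := Quotient.mk _
  have hq {g : Equiv.Perm (CombMap.GadgetDart TetraDart d)} (hg : g ∈ S) (y) : q (g y) = q y :=
    Quotient.sound (s := MulAction.orbitRel S _) ⟨⟨g, hg⟩, rfl⟩
  have hσ := hq (g := (tetraRefined d).σ) (Subgroup.subset_closure (by simp))
  have hα := hq (g := (tetraRefined d).α) (Subgroup.subset_closure (by simp))
  have hφ (x n i) : q (x, n, i + 1) = q (x, n, i) := by
    rw [← tetraRefined_φ, CombMap.φ, Equiv.Perm.mul_apply, hσ, hα]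
  have h0 (x n) (i : Fin 3) : q (x, n, i) = q (x, n, 0) := by
    have h1 := hφ x n 0
    have h2 := hφ x n 1
    fin_cases i
    · rfl
    · exact h1
    · exact h2.trans h1
  have e1 (x) : q (x, Sum.inl 0, 0) = q (tetra.α x, Sum.inl 0, 0) := by
    rw [← hα (x, _)]; rfl
  have e2 (x) (k : Fin d) : q (x, Sum.inr k, 0) = q (x, Sum.inl k.succ, 0) := by
    rw [← hα (x, _)]; rfl
  have e3 (x) (k : Fin d) : q (x, Sum.inr k, 0) = q (tetra.φ x, Sum.inl k.castSucc, 0) := by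
    rw [← h0 x _ 1, ← hα (x, _), ← h0 (tetra.φ x) _ 1]; rfl
  have e4 (x) : q (x, Sum.inl (Fin.last d), 0) = q (tetra.φ x, Sum.inl (Fin.last d), 0) := by
    rw [← h0 x _ 1, ← hα (x, _), ← h0 (tetra.φ x) _ 2]
    simp [tetraRefined_α, CombMap.gadgetRev, tetra_dual_σ]
  have hrot (k : Fin (d + 1)) : ∀ x, q (tetra.φ x, Sum.inl k, 0) = q (x, Sum.inl k, 0) := by
    induction k using Fin.reverseInduction with
    | last => exact fun x => (e4 x).symm
    | cast k ih =>
      intro x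
      obtain ⟨y, rfl⟩ := tetra.φ.surjective x
      rw [← e3, ← e3, e2, e2, ih]
  have hbase : ∀ x y, q (x, Sum.inl 0, 0) = q (y, Sum.inl 0, 0) :=
    eq_of_φ_α_invariant (f := fun x => q (x, Sum.inl 0, 0)) (hrot 0) fun x => (e1 x).symm
  obtain ⟨b⟩ : Nonempty TetraDart := ⟨⟨(0, 1), by decide⟩⟩
  have hinl (k : Fin (d + 1)) : ∀ x, q (x, Sum.inl k, 0) = q (b, Sum.inl 0, 0) := by
    induction k using Fin.induction with
    | zero => exact fun x => hbase x b
    | succ k ih => exact fun x => by rw [← e2, e3, ih]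
  have hall (y) : q y = q (b, Sum.inl 0, 0) := by
    obtain ⟨x, k | k, i⟩ := y
    · rw [h0, hinl]
    · rw [h0, e2, hinl]
  refine ⟨fun y z => ?_⟩
  have : q z = q y := by rw [hall z, hall y]
  exact (Quotient.exact this : MulAction.orbitRel S _ z y)

theorem tetraRefined_isPlane (d : ℕ) : (tetraRefined d).IsPlane := by
  refine ⟨tetraRefined_isPretransitive d, ?_⟩
  have hE := (tetraRefined d).card_darts_eq_two_mul_card_edge
  have hF : Nat.card (CombMap.GadgetDart TetraDart d) = 3 * Nat.card (tetraRefined d).Face :=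
    Quotient.card_eq_mul_card_of_ncard_eq _ 3 (tetraRefined_ncard_face d)
  have hV := card_vertex (d := d)
  have hD := card_gadgetDart d
  change Nat.card (CombMap.GadgetDart TetraDart d) = _ at hE
  omega

theorem tetraRefined_isTriangulation (d : ℕ) : (tetraRefined d).IsTriangulation :=
  ⟨tetraRefined_isPlane d, tetraRefined_isSimple d, tetraRefined_ncard_face d⟩

theorem adj_origin_succ (x : TetraDart) (n : Fin (d + 1) ⊕ Fin d) (i : Fin 3) :
    (tetraRefined d).graph.Adj ((tetraRefined d).origin (x, n, i))
      ((tetraRefined d).origin (x, n, i + 1)) := by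
  rw [← origin_α]
  exact ⟨((tetraRefined_isSimple d).1 _).symm, _, rfl, rfl⟩

theorem adj_level_same (x : TetraDart) {j : ℕ} (hj : j ≤ d) :
    (tetraRefined d).graph.Adj (levelVertex d x j) (levelVertex d (tetra.φ x) j) := by
  have := adj_origin_succ (d := d) (tetra.φ (tetra.φ x)) (Sum.inl ⟨j, by omega⟩) 0
  rw [origin_eq_levelVertex, origin_eq_levelVertex] at this
  simpa [place, Tetra.φ_φ_φ] using this

theorem adj_level_up (x : TetraDart) {j : ℕ} (hj : j ≤ d) :
    (tetraRefined d).graph.Adj (levelVertex d x j) (levelVertex d (tetra.φ x) (j + 1)) := by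
  have := adj_origin_succ (d := d) (tetra.φ x) (Sum.inl ⟨j, by omega⟩) 1
  rw [origin_eq_levelVertex, origin_eq_levelVertex] at this
  simpa [place, Tetra.φ_φ_φ] using this

theorem adj_level_up' (x : TetraDart) {j : ℕ} (hj : j ≤ d) :
    (tetraRefined d).graph.Adj (levelVertex d x j)
      (levelVertex d (tetra.φ (tetra.φ x)) (j + 1)) := by
  have := adj_origin_succ (d := d) (tetra.φ (tetra.φ x)) (Sum.inl ⟨j, by omega⟩) 2
  rw [origin_eq_levelVertex, origin_eq_levelVertex] at this
  simpa [place, Tetra.φ_φ_φ] using this.symm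

theorem exists_level_of_adj {u v : (tetraRefined d).Vertex} (h : (tetraRefined d).graph.Adj u v) :
    ∃ x j, j ≤ d ∧
      ((u = levelVertex d x j ∧
          (v = levelVertex d (tetra.φ x) j ∨ v = levelVertex d (tetra.φ (tetra.φ x)) j ∨
            v = levelVertex d (tetra.φ x) (j + 1) ∨
            v = levelVertex d (tetra.φ (tetra.φ x)) (j + 1))) ∨
        (u = levelVertex d x (j + 1) ∧
          (v = levelVertex d (tetra.φ x) j ∨ v = levelVertex d (tetra.φ (tetra.φ x)) j))) := by
  obtain ⟨-, ⟨x, n, i⟩, rfl, rfl⟩ := h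
  rw [origin_α, origin_eq_levelVertex, origin_eq_levelVertex]
  obtain k | k := n <;> have hk := k.2
  · fin_cases i
    · exact ⟨tetra.φ x, k, by omega, Or.inl ⟨rfl, Or.inl rfl⟩⟩
    · refine ⟨tetra.φ (tetra.φ x), k, by omega, Or.inl ⟨rfl, Or.inr (Or.inr (Or.inl ?_))⟩⟩
      rw [Tetra.φ_φ_φ]; rfl
    · exact ⟨x, k, by omega, Or.inr ⟨rfl, Or.inl rfl⟩⟩
  · fin_cases i
    · refine ⟨tetra.φ (tetra.φ x), k + 1, by omega, Or.inl ⟨rfl, Or.inr (Or.inl ?_)⟩⟩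
      rw [Tetra.φ_φ_φ]; rfl
    · refine ⟨tetra.φ x, k, by omega, Or.inr ⟨rfl, Or.inr ?_⟩⟩
      rw [Tetra.φ_φ_φ]; rfl
    · exact ⟨x, k, by omega, Or.inl ⟨rfl, Or.inr (Or.inr (Or.inr rfl))⟩⟩

theorem Set.ncard_le_of_subset_list {α : Type*} {s : Set α} (l : List α) (h : ∀ a ∈ s, a ∈ l) :
    s.ncard ≤ l.length := by
  classical
  calc s.ncard ≤ (l.toFinset : Set α).ncard :=
        Set.ncard_le_ncard (fun a ha => by simpa using h a ha) (Finset.finite_toSet _)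
    _ ≤ l.length := by rw [Set.ncard_coe_finset]; exact l.toFinset_card_le

theorem ncard_neighborSet_le (v : (tetraRefined d).Vertex) :
    ((tetraRefined d).graph.neighborSet v).ncard ≤ 9 := by
  obtain ⟨x, j, hj, rfl⟩ := exists_levelVertex_eq v
  rcases Nat.eq_zero_or_pos j with rfl | h0
  · -- At a corner, the neighbours lie at the levels `0` and `1` of the three faces that meet there.
    obtain ⟨y, rfl⟩ := tetra.φ.surjective x
    refine Set.ncard_le_of_subset_list [
      levelVertex d (tetra.φ (tetra.φ y)) 0, levelVertex d (tetra.φ (tetra.φ y)) 1,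
      levelVertex d (tetra.φ (tetra.φ (tetra.φ y))) 1,
      levelVertex d (tetra.φ (tetra.φ (tetra.σ y))) 0,
      levelVertex d (tetra.φ (tetra.φ (tetra.σ y))) 1,
      levelVertex d (tetra.φ (tetra.φ (tetra.φ (tetra.σ y)))) 1,
      levelVertex d (tetra.φ (tetra.φ (tetra.σ (tetra.σ y)))) 0,
      levelVertex d (tetra.φ (tetra.φ (tetra.σ (tetra.σ y)))) 1,
      levelVertex d (tetra.φ (tetra.φ (tetra.φ (tetra.σ (tetra.σ y))))) 1] fun w hw => ?_
    have key : ∀ y : TetraDart, (tetra.φ (tetra.φ (tetra.φ (tetra.φ (tetra.φ y))))).1.1 =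
        (tetra.φ (tetra.φ (tetra.φ (tetra.φ (tetra.σ (tetra.σ y)))))).1.1 := by decide
    have hσ3 : ∀ y : TetraDart, tetra.σ (tetra.σ (tetra.σ y)) = y := by decide
    have k1 : levelVertex d (tetra.φ (tetra.φ (tetra.φ y))) 0 =
        levelVertex d (tetra.φ (tetra.φ (tetra.σ (tetra.σ y)))) 0 :=
      levelVertex_zero_eq_iff.2 (key y)
    have k2 : levelVertex d (tetra.φ (tetra.φ (tetra.φ (tetra.σ y)))) 0 =
        levelVertex d (tetra.φ (tetra.φ y)) 0 :=
      levelVertex_zero_eq_iff.2 ((key (tetra.σ y)).trans (by rw [hσ3]))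
    have k3 : levelVertex d (tetra.φ (tetra.φ (tetra.φ (tetra.σ (tetra.σ y))))) 0 =
        levelVertex d (tetra.φ (tetra.φ (tetra.σ y))) 0 :=
      levelVertex_zero_eq_iff.2 ((key (tetra.σ (tetra.σ y))).trans (by rw [hσ3]))
    obtain ⟨z, i, hi, ⟨hu, hw'⟩ | ⟨hu, -⟩⟩ := exists_level_of_adj hw
    · obtain rfl : 0 = i :=
        level_eq_of_levelKey_eq ((levelVertex_eq_iff (Nat.zero_le _) (by omega)).1 hu)
      obtain ⟨z, rfl⟩ := tetra.φ.surjective z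
      have hyz := levelVertex_zero_eq_iff.1 hu
      rw [Tetra.φ_φ_φ, Tetra.φ_φ_φ] at hyz
      rcases Tetra.eq_or_of_fst_eq _ _ hyz with rfl | rfl | rfl <;>
        rcases hw' with rfl | rfl | rfl | rfl <;> simp [k1, k2, k3]
    · have := level_eq_of_levelKey_eq ((levelVertex_eq_iff (Nat.zero_le _) (by omega)).1 hu)
      omega
  · refine (Set.ncard_le_of_subset_list [
      levelVertex d (tetra.φ x) j, levelVertex d (tetra.φ (tetra.φ x)) j,
      levelVertex d (tetra.φ x) (j + 1), levelVertex d (tetra.φ (tetra.φ x)) (j + 1),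
      levelVertex d (tetra.φ x) (j - 1), levelVertex d (tetra.φ (tetra.φ x)) (j - 1),
      levelVertex d x (j - 1)] fun w hw => ?_).trans (by simp)
    obtain ⟨z, i, hi, ⟨hu, hw'⟩ | ⟨hu, hw'⟩⟩ := exists_level_of_adj hw
    · have hk := (levelVertex_eq_iff hj (by omega)).1 hu
      obtain rfl := level_eq_of_levelKey_eq hk
      obtain rfl := eq_of_levelKey_eq h0.ne' hi hk
      rcases hw' with rfl | rfl | rfl | rfl <;> simp
    · have hk := (levelVertex_eq_iff hj (by omega)).1 hu
      obtain rfl := level_eq_of_levelKey_eq hk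
      have hf := oppVertex_eq_of_levelKey_eq h0.ne' hj hk
      rcases Tetra.eq_or_of_oppVertex_eq _ _ hf with rfl | rfl | rfl <;>
        rcases hw' with rfl | rfl <;> simp [Tetra.φ_φ_φ]

end Triangulation

/-! ### Connected splits -/

section SameSide

variable {V : Type} {G : SimpleGraph V}

/-- Two adjacent vertices in the same block. -/
def SameSide (G : SimpleGraph V) (B : Set V) (u v : V) : Prop := G.Adj u v ∧ (u ∈ B ↔ v ∈ B)

instance (B : Set V) : Std.Symm (SameSide G B) :=
  ⟨fun _ _ h => ⟨h.1.symm, h.2.symm⟩⟩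

theorem mem_iff_of_reflTransGen_sameSide {B : Set V} {u v : V}
    (h : Relation.ReflTransGen (SameSide G B) u v) : u ∈ B ↔ v ∈ B := by
  induction h with
  | refl => rfl
  | tail _ h ih => exact ih.trans h.2

theorem isConnSplit_iff {B : Set V} : IsConnSplit G B ↔
    ∀ u v, (u ∈ B ↔ v ∈ B) → Relation.ReflTransGen (SameSide G B) u v := by
  have lift (A : Set V) (hA : ∀ u v, u ∈ A → v ∈ A → (u ∈ B ↔ v ∈ B)) (u v : A)
      (h : (G.induce A).Reachable u v) :
      Relation.ReflTransGen (SameSide G B) (u : V) (v : V) := by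
    rw [SimpleGraph.reachable_iff_reflTransGen] at h
    exact Relation.ReflTransGen.lift (p := SameSide G B) Subtype.val
      (fun a b hab => ⟨hab, hA a b a.2 b.2⟩) _ _ h
  have unlift (A : Set V) (hA : ∀ u v, u ∈ A → (u ∈ B ↔ v ∈ B) → v ∈ A) (u : A) (v : V)
      (h : Relation.ReflTransGen (SameSide G B) (u : V) v) :
      ∃ hv : v ∈ A, (G.induce A).Reachable u ⟨v, hv⟩ := by
    induction h with
    | refl => exact ⟨u.2, by rfl⟩
    | @tail b c _ hbc ih =>
      obtain ⟨hb, hr⟩ := ih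
      exact ⟨hA b c hb hbc.2, hr.trans (SimpleGraph.Adj.reachable hbc.1)⟩
  constructor
  · intro h u v huv
    by_cases hu : u ∈ B
    · exact lift B (fun _ _ h1 h2 => by simp [h1, h2]) ⟨u, hu⟩ ⟨v, huv.1 hu⟩ (h.1 _ _)
    · exact lift Bᶜ (fun a b (h1 : a ∉ B) (h2 : b ∉ B) => by simp [h1, h2]) ⟨u, hu⟩
        ⟨v, fun hv => hu (huv.2 hv)⟩ (h.2 _ _)
  · intro h
    refine ⟨fun u v => ?_, fun u v => ?_⟩
    · exact (unlift B (fun _ _ h1 h2 => h2.1 h1) u v (h u v (by simp [u.2, v.2]))).2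
    · have hu : (u : V) ∉ B := u.2
      have hv : (v : V) ∉ B := v.2
      exact (unlift Bᶜ (fun _ _ (h1 : _ ∉ B) h2 h3 => h1 (h2.2 h3)) u v
        (h u v (by simp [hu, hv]))).2

theorem isConnSplit_of_complete (h : ∀ u v, u ≠ v → G.Adj u v) (B : Set V) :
    IsConnSplit G B :=
  isConnSplit_iff.2 fun u v huv => by
    by_cases e : u = v
    · rw [e]
    · exact Relation.ReflTransGen.single ⟨h u v e, huv⟩

/-- The preimage of a partition under an automorphism of the graph. -/
def ConnPartition.pullback (e : G ≃g G) (P : ConnPartition G) : ConnPartition G :=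
  ⟨e ⁻¹' P.block, isConnSplit_iff.2 fun u v huv => by
    have := Relation.ReflTransGen.lift (p := SameSide G (e ⁻¹' P.block)) e.symm
      (fun a b hab => ⟨e.symm.map_adj_iff.2 hab.1, by simpa using hab.2⟩) _ _
      (isConnSplit_iff.1 P.conn (e u) (e v) huv)
    simpa [Function.onFun] using this⟩

theorem ConnPartition.pullback_injective (e : G ≃g G) :
    Function.Injective (ConnPartition.pullback e) := by
  intro P Q h
  refine ConnPartition.ext (e.surjective.preimage_injective (congrArg ConnPartition.block h))

end SameSide

namespace CombMap

variable {D : Type} (M : CombMap D) (e : Equiv.Perm D)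

/-- The action on the vertices of an automorphism of a map. -/
def vertexEquiv (hσ : ∀ x, e (M.σ x) = M.σ (e x)) : M.Vertex ≃ M.Vertex :=
  Quotient.congr e fun x y => by
    change M.σ.SameCycle x y ↔ M.σ.SameCycle (e x) (e y)
    have hc : e * M.σ * e⁻¹ = M.σ := by
      ext z
      simp [hσ]
    conv_rhs => rw [← hc]
    rw [Equiv.Perm.sameCycle_conj]
    simp

/-- The automorphism of the underlying graph given by an automorphism of a map. -/
def graphIso (hσ : ∀ x, e (M.σ x) = M.σ (e x)) (hα : ∀ x, e (M.α x) = M.α (e x)) :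
    M.graph ≃g M.graph where
  toEquiv := M.vertexEquiv e hσ
  map_rel_iff' := by
    intro u v
    refine and_congr (M.vertexEquiv e hσ).injective.ne_iff ⟨?_, ?_⟩
    · rintro ⟨x, h1, h2⟩
      obtain ⟨x, rfl⟩ := e.surjective x
      rw [← hα] at h2
      exact ⟨x, (M.vertexEquiv e hσ).injective h1, (M.vertexEquiv e hσ).injective h2⟩
    · rintro ⟨x, rfl, rfl⟩
      exact ⟨e x, rfl, by rw [← hα]; rfl⟩

end CombMap

/-! ### Colourings of the faces of `T_d(K_4)` -/

section Faces

variable {d : ℕ}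

theorem eq_or_of_oppVertex_ne {x y : TetraDart} (hf : oppVertex x = oppVertex y) (hne : x ≠ y) :
    y = tetra.φ x ∨ y = tetra.φ (tetra.φ x) :=
  (Tetra.eq_or_of_oppVertex_eq x y hf).resolve_left hne.symm

theorem adj_level_of_ne {x y : TetraDart} (hf : oppVertex x = oppVertex y) (hne : x ≠ y) {j : ℕ}
    (hj : j ≤ d) : (tetraRefined d).graph.Adj (levelVertex d x j) (levelVertex d y j) := by
  rcases eq_or_of_oppVertex_ne hf hne with rfl | rfl
  · exact adj_level_same x hj
  · have := adj_level_same (tetra.φ (tetra.φ x)) hj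
    rw [Tetra.φ_φ_φ] at this
    exact this.symm

theorem adj_level_succ_of_ne {x y : TetraDart} (hf : oppVertex x = oppVertex y) (hne : x ≠ y)
    {j : ℕ} (hj : j ≤ d) :
    (tetraRefined d).graph.Adj (levelVertex d x j) (levelVertex d y (j + 1)) := by
  rcases eq_or_of_oppVertex_ne hf hne with rfl | rfl
  · exact adj_level_up x hj
  · exact adj_level_up' x hj

theorem adj_level_zero {x y : TetraDart} (h : levelVertex d x 0 ≠ levelVertex d y 0) :
    (tetraRefined d).graph.Adj (levelVertex d x 0) (levelVertex d y 0) := by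
  have key : ∀ x y : TetraDart, (tetra.φ (tetra.φ x)).1.1 ≠ (tetra.φ (tetra.φ y)).1.1 →
      ∃ z, (tetra.φ (tetra.φ x)).1.1 = (tetra.φ (tetra.φ z)).1.1 ∧
        (tetra.φ (tetra.φ y)).1.1 = (tetra.φ (tetra.φ (tetra.φ z))).1.1 := by decide
  rw [Ne, levelVertex_zero_eq_iff] at h
  obtain ⟨z, h1, h2⟩ := key x y h
  rw [levelVertex_zero_eq_iff.2 h1, levelVertex_zero_eq_iff.2 h2]
  exact adj_level_same z (Nat.zero_le _)

/-- The vertices strictly inside the face of `K_4` opposite to the vertex `f`. -/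
def InFace (d : ℕ) (f : Fin 4) (u : (tetraRefined d).Vertex) : Prop :=
  ∃ x j, oppVertex x = f ∧ j ≤ d ∧ u = levelVertex d x (j + 1)

theorem not_inFace_level_zero (f : Fin 4) (x : TetraDart) : ¬ InFace d f (levelVertex d x 0) := by
  rintro ⟨y, j, -, hj, h⟩
  have := level_eq_of_levelKey_eq ((levelVertex_eq_iff (by omega) (by omega)).1 h)
  omega

theorem inFace_level_succ_iff {f : Fin 4} {x : TetraDart} {j : ℕ} (hj : j ≤ d) :
    InFace d f (levelVertex d x (j + 1)) ↔ oppVertex x = f := by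
  constructor
  · rintro ⟨y, k, hf, hk, h⟩
    have h := (levelVertex_eq_iff (by omega) (by omega)).1 h
    obtain rfl : j = k := by have := level_eq_of_levelKey_eq h; omega
    rw [← hf, oppVertex_eq_of_levelKey_eq (by omega) (by omega) h]
  · intro h
    exact ⟨x, j, h, hj, rfl⟩

/-- Only its corners separate the inside of a face from the rest of the graph. -/
theorem InFace.adj {f : Fin 4} {u v : (tetraRefined d).Vertex} (hu : InFace d f u)
    (h : (tetraRefined d).graph.Adj u v) :
    InFace d f v ∨ ∃ x, oppVertex x = f ∧ v = levelVertex d x 0 := by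
  have key (y : TetraDart) (hy : oppVertex y = f) (j : ℕ) (hj : j ≤ d + 1) :
      InFace d f (levelVertex d y j) ∨ ∃ x, oppVertex x = f ∧ levelVertex d y j =
        levelVertex d x 0 := by
    cases j with
    | zero => exact Or.inr ⟨y, hy, rfl⟩
    | succ j => exact Or.inl ⟨y, j, hy, by omega, rfl⟩
  obtain ⟨x, j, hj, ⟨rfl, hv⟩ | ⟨rfl, hv⟩⟩ := exists_level_of_adj h
  · cases j with
    | zero => exact (not_inFace_level_zero f x hu).elim
    | succ j =>
      have hx := (inFace_level_succ_iff (by omega)).1 hu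
      rcases hv with rfl | rfl | rfl | rfl <;>
        exact key _ (by simpa only [Tetra.oppVertex_φ]) _ (by omega)
  · have hx := (inFace_level_succ_iff hj).1 hu
    rcases hv with rfl | rfl <;> exact key _ (by simpa only [Tetra.oppVertex_φ]) _ (by omega)

/-- The vertex `u` is connected to an original vertex inside its block. -/
def Rooted (B : Set (tetraRefined d).Vertex) (u : (tetraRefined d).Vertex) : Prop :=
  ∃ x, Relation.ReflTransGen (SameSide (tetraRefined d).graph B) u (levelVertex d x 0)

/-- The original vertices are pairwise adjacent, so that it suffices to connect every vertex to
one of them. -/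
theorem isConnSplit_of_rooted {B : Set (tetraRefined d).Vertex} (h : ∀ u, Rooted B u) :
    IsConnSplit (tetraRefined d).graph B := by
  refine isConnSplit_iff.2 fun u v huv => ?_
  obtain ⟨x, hx⟩ := h u
  obtain ⟨y, hy⟩ := h v
  have hxy : levelVertex d x 0 ∈ B ↔ levelVertex d y 0 ∈ B := by
    rw [← mem_iff_of_reflTransGen_sameSide hx, ← mem_iff_of_reflTransGen_sameSide hy, huv]
  refine hx.trans (Relation.ReflTransGen.trans ?_
    (Std.Symm.symm _ _ hy))
  by_cases e : levelVertex d x 0 = levelVertex d y 0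
  · rw [e]
  · exact Relation.ReflTransGen.single ⟨adj_level_zero e, hxy⟩

theorem rooted_level_zero (B : Set (tetraRefined d).Vertex) (x : TetraDart) :
    Rooted B (levelVertex d x 0) := ⟨x, Relation.ReflTransGen.refl⟩

theorem Rooted.of_sameSide {B : Set (tetraRefined d).Vertex} {u v : (tetraRefined d).Vertex}
    (hv : Rooted B v) (h : SameSide (tetraRefined d).graph B u v) : Rooted B u := by
  obtain ⟨x, hx⟩ := hv
  exact ⟨x, Relation.ReflTransGen.head h hx⟩

/-- If in a face each block that occurs at the level `j + 1` has there a vertex with a neighbour in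
the same block at the level `j`, then all vertices in this face are connected to the corners. -/
theorem rooted_of_steps {B : Set (tetraRefined d).Vertex} {f : Fin 4}
    (h : ∀ x j, oppVertex x = f → j ≤ d → ∃ y z, oppVertex y = f ∧ oppVertex z = f ∧ y ≠ z ∧
      (levelVertex d y (j + 1) ∈ B ↔ levelVertex d x (j + 1) ∈ B) ∧
      (levelVertex d z j ∈ B ↔ levelVertex d x (j + 1) ∈ B))
    (j : ℕ) (hj : j ≤ d + 1) (x : TetraDart) (hx : oppVertex x = f) :
    Rooted B (levelVertex d x j) := by
  induction j generalizing x with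
  | zero => exact rooted_level_zero B x
  | succ j ih =>
    obtain ⟨y, z, hy, hz, hne, h1, h2⟩ := h x j hx (by omega)
    have ry : Rooted B (levelVertex d y (j + 1)) :=
      (ih (by omega) z hz).of_sameSide
        ⟨(adj_level_succ_of_ne (hz.trans hy.symm) hne.symm (by omega)).symm, by rw [h1, h2]⟩
    by_cases e : levelVertex d x (j + 1) = levelVertex d y (j + 1)
    · rwa [e]
    · have hjd : j + 1 ≤ d := by
        by_contra hlt
        obtain rfl : j = d := by omega
        exact e (levelVertex_last_eq (hx.trans hy.symm))
      exact ry.of_sameSide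
        ⟨adj_level_of_ne (hx.trans hy.symm) (fun e' => e (by rw [e'])) hjd, h1.symm⟩

/-- The position of a dart in its face. -/
def cornerIndex (x : TetraDart) : Fin 3 :=
  Fin.ofNat 3 (if x.1.1 < oppVertex x then x.1.1 else x.1.1 - 1)

theorem cornerIndex_injOn : ∀ x y : TetraDart, oppVertex x = oppVertex y →
    cornerIndex x = cornerIndex y → x = y := by decide

theorem exists_cornerIndex_eq : ∀ (f : Fin 4) (k : Fin 3), ∃ x : TetraDart, oppVertex x = f ∧
    cornerIndex x = k := by decide

/-- The six colourings of a triangle with two colours that use both: the binary digits of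
`1, …, 6`. -/
def mixedColoring (s : Fin 6) (k : Fin 3) : Bool := Nat.testBit (s + 1) k

theorem mixedColoring_injective : ∀ s t : Fin 6, (∀ k, mixedColoring s k = mixedColoring t k) →
    s = t := by decide

theorem exists_mixedColoring_eq : ∀ c : Fin 3 → Bool, (∃ k, c k = true) → (∃ k, c k = false) →
    ∃ s, ∀ k, mixedColoring s k = c k := by decide

theorem exists_mixedColoring_eq_true : ∀ s : Fin 6, ∃ k, mixedColoring s k = true := by decide

/-- Let a mixed triangle be followed by a differently coloured mixed one. Then each colour has a
vertex in the second triangle that is adjacent to a vertex of this colour in the first one: vertices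
of the two triangles are adjacent when their positions differ. -/
theorem mixedColoring_step : ∀ s t : Fin 6, s ≠ t → ∀ k, ∃ k₁ k₂, k₁ ≠ k₂ ∧
    mixedColoring t k₁ = mixedColoring t k ∧ mixedColoring s k₂ = mixedColoring t k := by
  decide

/-- The block obtained from `B` by giving the level `j ≤ d` inside the face `f` the colouring
`s j`; the innermost vertex is put into the block. -/
def recolor (f : Fin 4) (B : Set (tetraRefined d).Vertex) (s : ℕ → Fin 6) :
    Set (tetraRefined d).Vertex :=
  {u | (¬ InFace d f u ∧ u ∈ B) ∨ ∃ x j, oppVertex x = f ∧ j ≤ d ∧ u = levelVertex d x (j + 1) ∧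
    (j = d ∨ mixedColoring (s (j + 1)) (cornerIndex x) = true)}

section Recolor

variable {f : Fin 4} {B : Set (tetraRefined d).Vertex} {s : ℕ → Fin 6}

theorem mem_recolor_of_not_inFace {u : (tetraRefined d).Vertex} (hu : ¬ InFace d f u) :
    u ∈ recolor f B s ↔ u ∈ B := by
  constructor
  · rintro (h | ⟨x, j, hx, hj, h, -⟩)
    · exact h.2
    · exact (hu ⟨x, j, hx, hj, h⟩).elim
  · exact fun h => Or.inl ⟨hu, h⟩

theorem level_succ_mem_recolor {x : TetraDart} (hx : oppVertex x = f) {j : ℕ} (hj : j ≤ d) :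
    levelVertex d x (j + 1) ∈ recolor f B s ↔
      (j = d ∨ mixedColoring (s (j + 1)) (cornerIndex x) = true) := by
  constructor
  · rintro (h | ⟨y, k, hy, hk, h, hc⟩)
    · exact (h.1 ⟨x, j, hx, hj, rfl⟩).elim
    · have h := (levelVertex_eq_iff (by omega) (by omega)).1 h
      obtain rfl : j = k := by have := level_eq_of_levelKey_eq h; omega
      rcases hc with hc | hc
      · exact Or.inl hc
      · by_cases hjd : j = d
        · exact Or.inl hjd
        · rw [eq_of_levelKey_eq (by omega) (by omega) h]
          exact Or.inr hc
  · exact fun h => Or.inr ⟨x, j, hx, hj, rfl, h⟩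

theorem level_mem_recolor
    (h0 : ∀ x, oppVertex x = f →
      (levelVertex d x 0 ∈ B ↔ mixedColoring (s 0) (cornerIndex x) = true))
    {x : TetraDart} (hx : oppVertex x = f) {j : ℕ} (hj : j ≤ d) :
    levelVertex d x j ∈ recolor f B s ↔ mixedColoring (s j) (cornerIndex x) = true := by
  cases j with
  | zero => rw [mem_recolor_of_not_inFace (not_inFace_level_zero f x), h0 x hx]
  | succ j =>
    rw [level_succ_mem_recolor hx (by omega)]
    simp only [or_iff_right_iff_imp]
    omega

theorem rooted_of_isConnSplit (hB : IsConnSplit (tetraRefined d).graph B)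
    (h1 : ∃ x, levelVertex d x 0 ∈ B) (h2 : ∃ x, levelVertex d x 0 ∉ B)
    (u : (tetraRefined d).Vertex) : Rooted B u := by
  obtain ⟨x, hx⟩ := h1
  obtain ⟨y, hy⟩ := h2
  by_cases hu : u ∈ B
  · exact ⟨x, isConnSplit_iff.1 hB _ _ (by simp [hu, hx])⟩
  · exact ⟨y, isConnSplit_iff.1 hB _ _ (by simp [hu, hy])⟩

theorem isConnSplit_recolor (hB : IsConnSplit (tetraRefined d).graph B)
    (h1 : ∃ x, levelVertex d x 0 ∈ B) (h2 : ∃ x, levelVertex d x 0 ∉ B)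
    (h0 : ∀ x, oppVertex x = f →
      (levelVertex d x 0 ∈ B ↔ mixedColoring (s 0) (cornerIndex x) = true))
    (hs : ∀ j < d, s j ≠ s (j + 1)) :
    IsConnSplit (tetraRefined d).graph (recolor f B s) := by
  refine isConnSplit_of_rooted fun u => ?_
  by_cases hu : InFace d f u
  · obtain ⟨x, j, hx, hj, rfl⟩ := hu
    refine rooted_of_steps (f := f) (fun x j hx hj => ?_) (j + 1) (by omega) x hx
    rcases Nat.lt_or_ge j d with hjd | hjd
    · obtain ⟨k₁, k₂, hne, e1, e2⟩ := mixedColoring_step _ _ (hs j hjd) (cornerIndex x)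
      obtain ⟨y, hy, rfl⟩ := exists_cornerIndex_eq f k₁
      obtain ⟨z, hz, rfl⟩ := exists_cornerIndex_eq f k₂
      refine ⟨y, z, hy, hz, fun e => hne (by rw [e]), ?_, ?_⟩
      · rw [level_mem_recolor h0 hy hjd, level_mem_recolor h0 hx hjd, e1]
      · rw [level_mem_recolor h0 hz hj, level_mem_recolor h0 hx hjd, e2]
    · obtain rfl : j = d := by omega
      obtain ⟨k, hk⟩ := exists_mixedColoring_eq_true (s j)
      obtain ⟨z, hz, rfl⟩ := exists_cornerIndex_eq f k
      have hy : oppVertex (tetra.φ z) = f := by rw [Tetra.oppVertex_φ, hz]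
      refine ⟨tetra.φ z, z, hy, hz, Tetra.φ_ne z, ?_, ?_⟩
      · rw [level_succ_mem_recolor hy le_rfl, level_succ_mem_recolor hx le_rfl]
        simp
      · rw [level_mem_recolor h0 hz le_rfl, level_succ_mem_recolor hx le_rfl]
        simp [hk]
  · -- A path to an original vertex outside the face `f` does not enter this face before it
    -- meets an original vertex.
    obtain ⟨x, hx⟩ := rooted_of_isConnSplit hB h1 h2 u
    induction hx using Relation.ReflTransGen.head_induction_on with
    | refl => exact rooted_level_zero _ x
    | @head u v huv _ ih =>
      by_cases hv : InFace d f v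
      · rcases hv.adj huv.1.symm with h | ⟨y, -, rfl⟩
        · exact (hu h).elim
        · exact rooted_level_zero _ y
      · exact (ih hv).of_sameSide
          ⟨huv.1, by rw [mem_recolor_of_not_inFace hu, mem_recolor_of_not_inFace hv, huv.2]⟩

end Recolor

end Faces

/-! ### Partitions of `K_4` -/

section TetraPartitions

theorem tetra_adj (u v : tetra.Vertex) (h : u ≠ v) : tetra.graph.Adj u v := by
  induction u using Quotient.inductionOn with
  | h x =>
    induction v using Quotient.inductionOn with
    | h y =>
      have hne : x.1.1 ≠ y.1.1 := fun e => h (Tetra.origin_eq_iff.2 e)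
      exact ⟨h, ⟨(x.1.1, y.1.1), hne⟩, Tetra.origin_eq_iff.2 rfl, Tetra.origin_eq_iff.2 rfl⟩

/-- The vertices of `K_4`, as names in `Fin 4`, that lie in the first block. -/
def tetraBlock (P : ConnPartition tetra.graph) (p : Fin 4) : Prop :=
  ∃ x : TetraDart, x.1.1 = p ∧ tetra.origin x ∈ P.block

theorem tetraBlock_fst {P : ConnPartition tetra.graph} {x : TetraDart} :
    tetraBlock P x.1.1 ↔ tetra.origin x ∈ P.block :=
  ⟨fun ⟨_, h1, h2⟩ => Tetra.origin_eq_iff.2 h1 ▸ h2, fun h => ⟨x, rfl, h⟩⟩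

theorem allFacesMixed_iff {P : ConnPartition tetra.graph} : tetra.AllFacesMixed P ↔
    ∀ f, (∃ p, p ≠ f ∧ tetraBlock P p) ∧ ∃ p, p ≠ f ∧ ¬ tetraBlock P p := by
  have h1 : ∀ x : TetraDart, x.1.1 ≠ oppVertex x := by decide
  have h2 : ∀ (x : TetraDart) (p : Fin 4), p ≠ oppVertex x →
      ∃ y : TetraDart, oppVertex x = oppVertex y ∧ y.1.1 = p := by decide
  have h3 : ∀ f : Fin 4, ∃ x : TetraDart, oppVertex x = f := by decide
  have hf {x y : TetraDart} : tetra.face x = tetra.face y ↔ oppVertex x = oppVertex y := by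
    constructor
    · exact fun h => (tetra.face_eq_iff.1 h).apply_eq_of_invariant Tetra.oppVertex_φ
    · intro h
      rcases Tetra.eq_or_of_oppVertex_eq x y h with rfl | rfl | rfl
      · rfl
      · rw [tetra.face_φ]
      · rw [tetra.face_φ, tetra.face_φ]
  constructor
  · intro h f
    obtain ⟨x, rfl⟩ := h3 f
    obtain ⟨⟨y, hy, hyP⟩, ⟨z, hz, hzP⟩⟩ := h (tetra.face x)
    exact ⟨⟨y.1.1, hf.1 hy ▸ h1 y, tetraBlock_fst.2 hyP⟩,
      ⟨z.1.1, hf.1 hz ▸ h1 z, fun h => hzP (tetraBlock_fst.1 h)⟩⟩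
  · intro h f
    induction f using Quotient.inductionOn with
    | h x =>
      obtain ⟨⟨p, hp, hpP⟩, ⟨q, hq, hqP⟩⟩ := h (oppVertex x)
      obtain ⟨y, hy, rfl⟩ := h2 x p hp
      obtain ⟨z, hz, rfl⟩ := h2 x q hq
      exact ⟨⟨y, hf.2 hy.symm, tetraBlock_fst.1 hpP⟩,
        ⟨z, hf.2 hz.symm, fun h => hqP (tetraBlock_fst.2 h)⟩⟩

theorem exists_allFacesMixed : ∃ P : ConnPartition tetra.graph, tetra.AllFacesMixed P := by
  let P : ConnPartition tetra.graph :=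
    ⟨{v | ∃ x : TetraDart, x.1.1 < 2 ∧ tetra.origin x = v}, isConnSplit_of_complete tetra_adj _⟩
  have hP (p : Fin 4) : tetraBlock P p ↔ p < 2 := by
    have h : ∀ p : Fin 4, ∃ x : TetraDart, x.1.1 = p := by decide
    obtain ⟨x, rfl⟩ := h p
    rw [tetraBlock_fst]
    constructor
    · rintro ⟨y, hy, e⟩
      rwa [← Tetra.origin_eq_iff.1 e]
    · exact fun h => ⟨x, h, rfl⟩
  refine ⟨P, allFacesMixed_iff.2 ?_⟩
  simp only [hP]
  decide

/-- In a mixed partition each block has two vertices. -/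
theorem exists_partner {g : Fin 4 → Prop} (h : ∀ f, (∃ p, p ≠ f ∧ g p) ∧ ∃ p, p ≠ f ∧ ¬ g p)
    (v : Fin 4) : ∃ w, w ≠ v ∧ (g w ↔ g v) ∧ ∀ u, u ≠ v → u ≠ w → (g u ↔ ¬ g v) := by
  classical
  have key : ∀ g : Fin 4 → Bool,
      (∀ f, (∃ p, p ≠ f ∧ g p = true) ∧ ∃ p, p ≠ f ∧ ¬ g p = true) →
      ∀ v, ∃ w, w ≠ v ∧ (g w = true ↔ g v = true) ∧
        ∀ u, u ≠ v → u ≠ w → (g u = true ↔ ¬ g v = true) := by decide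
  simpa using key (fun p => decide (g p)) (by simpa using h) v

/-- A rotation of order three changes every mixed partition, even up to exchanging the blocks. -/
theorem not_rotation_invariant {g : Fin 4 → Prop}
    (h : ∀ f, (∃ p, p ≠ f ∧ g p) ∧ ∃ p, p ≠ f ∧ ¬ g p) :
    ¬ ((∀ p, g p ↔ g (c[1, 2, 3] p)) ∨ ∀ p, g p ↔ ¬ g (c[1, 2, 3] p)) := by
  classical
  have key : ∀ g : Fin 4 → Bool,
      (∀ f, (∃ p, p ≠ f ∧ g p = true) ∧ ∃ p, p ≠ f ∧ ¬ g p = true) →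
      ¬ ((∀ p, g p = true ↔ g ((c[1, 2, 3] : Equiv.Perm (Fin 4)) p) = true) ∨
        ∀ p, g p = true ↔ ¬ g ((c[1, 2, 3] : Equiv.Perm (Fin 4)) p) = true) := by decide
  simpa using key (fun p => decide (g p)) (by simpa using h)

/-- The rotation of `K_4` around the vertex `0`. -/
def tetraRotation : Equiv.Perm TetraDart where
  toFun x := ⟨((c[1, 2, 3] : Equiv.Perm (Fin 4)) x.1.1, (c[1, 2, 3] : Equiv.Perm (Fin 4)) x.1.2),
    fun h => x.2 (Equiv.injective _ h)⟩
  invFun x := ⟨((c[1, 2, 3] : Equiv.Perm (Fin 4)).symm x.1.1,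
    (c[1, 2, 3] : Equiv.Perm (Fin 4)).symm x.1.2), fun h => x.2 (Equiv.injective _ h)⟩
  left_inv x := by simp
  right_inv x := by simp

theorem tetraRotation_σ : ∀ x, tetraRotation (tetra.σ x) = tetra.σ (tetraRotation x) := by decide

theorem tetraRotation_α : ∀ x, tetraRotation (tetra.α x) = tetra.α (tetraRotation x) := by decide

/-- A partition of `K_4`, rotated. -/
noncomputable def ConnPartition.rotate (P : ConnPartition tetra.graph) :
    ConnPartition tetra.graph :=
  P.pullback (tetra.graphIso tetraRotation tetraRotation_σ tetraRotation_α)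

theorem tetraBlock_rotate (P : ConnPartition tetra.graph) (p : Fin 4) :
    tetraBlock P.rotate p ↔ tetraBlock P ((c[1, 2, 3] : Equiv.Perm (Fin 4)) p) := by
  have h : ∀ p : Fin 4, ∃ x : TetraDart, x.1.1 = p := by decide
  obtain ⟨x, rfl⟩ := h p
  rw [tetraBlock_fst]
  exact (tetraBlock_fst (x := tetraRotation x)).symm

theorem allFacesMixed_rotate {P : ConnPartition tetra.graph} (h : tetra.AllFacesMixed P) :
    tetra.AllFacesMixed P.rotate := by
  rw [allFacesMixed_iff] at h ⊢
  intro f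
  simp only [tetraBlock_rotate]
  obtain ⟨⟨p, hp, hpP⟩, ⟨q, hq, hqP⟩⟩ := h ((c[1, 2, 3] : Equiv.Perm (Fin 4)) f)
  refine ⟨⟨(c[1, 2, 3] : Equiv.Perm (Fin 4)).symm p, ?_, by simpa using hpP⟩,
    ⟨(c[1, 2, 3] : Equiv.Perm (Fin 4)).symm q, ?_, by simpa using hqP⟩⟩
  · rintro rfl; simp at hp
  · rintro rfl; simp at hq

end TetraPartitions

/-! ### Partitions with a given mixed restriction -/

section Fiber

variable {d : ℕ} {P : ConnPartition tetra.graph}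

/-- The partitions of `T_d(K_4)` that restrict to `P` on the original vertices. -/
def tetraFiber (d : ℕ) (P : ConnPartition tetra.graph) :
    Set (ConnPartition (tetraRefined d).graph) :=
  tetra.restrictionFiber d P

theorem mem_tetraFiber_iff {Q : ConnPartition (tetraRefined d).graph} :
    Q ∈ tetraFiber d P ↔
      ∀ x, levelVertex d x 0 ∈ Q.block ↔ tetraBlock P (tetra.φ (tetra.φ x)).1.1 := by
  constructor
  · intro h x
    have := h (tetra.φ (tetra.φ x))
    rwa [originalVertex_eq, Tetra.φ_φ_φ, ← tetraBlock_fst] at this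
  · intro h x
    rw [originalVertex_eq, ← tetraBlock_fst]
    have := h (tetra.φ x)
    rwa [Tetra.φ_φ_φ] at this

theorem tetraBlock_iff_or_of_unorder_eq {P' : ConnPartition tetra.graph}
    {Q Q' : ConnPartition (tetraRefined d).graph} (hQ : Q ∈ tetraFiber d P)
    (hQ' : Q' ∈ tetraFiber d P') (h : Q.unorder = Q'.unorder) :
    (Q = Q' ∧ ∀ p, tetraBlock P p ↔ tetraBlock P' p) ∨ ∀ p, tetraBlock P p ↔ ¬ tetraBlock P' p := by
  rw [mem_tetraFiber_iff] at hQ hQ'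
  have hx : ∀ p : Fin 4, ∃ x : TetraDart, (tetra.φ (tetra.φ x)).1.1 = p := by decide
  rcases ConnPartition.unorder_eq_iff.1 h with rfl | rfl
  · left
    refine ⟨rfl, fun p => ?_⟩
    obtain ⟨x, rfl⟩ := hx p
    rw [← hQ, ← hQ']
  · right
    intro p
    obtain ⟨x, rfl⟩ := hx p
    rw [← hQ, ← hQ']
    rfl

theorem injOn_unorder_tetraFiber :
    Set.InjOn ConnPartition.unorder (tetraFiber d P) := by
  intro Q hQ Q' hQ' h
  rcases tetraBlock_iff_or_of_unorder_eq hQ hQ' h with h | h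
  · exact h.1
  · have := h 0
    tauto

theorem disjoint_unorder_rotate (hP : tetra.AllFacesMixed P) :
    Disjoint (ConnPartition.unorder '' tetraFiber d P)
      (ConnPartition.unorder '' tetraFiber d P.rotate) := by
  rw [Set.disjoint_left]
  rintro _ ⟨Q, hQ, rfl⟩ ⟨Q', hQ', h⟩
  refine not_rotation_invariant (allFacesMixed_iff.1 hP) ?_
  simp only [← tetraBlock_rotate]
  exact (tetraBlock_iff_or_of_unorder_eq hQ hQ' h.symm).imp_left And.right

/-- The rotation of `K_4` as an automorphism of `T_d(K_4)`. -/
def refinedRotation (d : ℕ) : Equiv.Perm (CombMap.GadgetDart TetraDart d) :=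
  tetraRotation.prodCongr (Equiv.refl _)

theorem tetraRotation_φ (x : TetraDart) :
    tetraRotation (tetra.φ x) = tetra.φ (tetraRotation x) := by
  rw [CombMap.φ, Equiv.Perm.mul_apply, tetraRotation_σ, tetraRotation_α, Equiv.Perm.mul_apply]

theorem tetraRotation_φ_symm (x : TetraDart) :
    tetraRotation (tetra.φ.symm x) = tetra.φ.symm (tetraRotation x) := by
  rw [Equiv.eq_symm_apply, ← tetraRotation_φ, Equiv.apply_symm_apply]

theorem refinedRotation_α (y : CombMap.GadgetDart TetraDart d) :
    refinedRotation d ((tetraRefined d).α y) = (tetraRefined d).α (refinedRotation d y) := by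
  rw [tetraRefined_α, tetraRefined_α]
  obtain ⟨x, k | k, i⟩ := y
  · fin_cases i
    · by_cases h : k = 0 <;>
        simp [refinedRotation, CombMap.gadgetRev, h, tetra_dual_α, tetraRotation_α]
    · by_cases h : k = Fin.last d <;>
        simp [refinedRotation, CombMap.gadgetRev, h, tetra_dual_σ, tetraRotation_φ,
          tetraRotation_φ_symm]
    · by_cases h : k = Fin.last d <;>
        simp [refinedRotation, CombMap.gadgetRev, h, tetra_dual_σ, tetraRotation_φ,
          tetraRotation_φ_symm]
  · fin_cases i <;>
      simp [refinedRotation, CombMap.gadgetRev, tetra_dual_σ, tetraRotation_φ,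
        tetraRotation_φ_symm]

theorem refinedRotation_σ (y : CombMap.GadgetDart TetraDart d) :
    refinedRotation d ((tetraRefined d).σ y) = (tetraRefined d).σ (refinedRotation d y) := by
  have h := refinedRotation_α y
  rw [tetraRefined_α, tetraRefined_α] at h
  rw [tetraRefined_σ, tetraRefined_σ, ← h]
  rfl

theorem ncard_tetraFiber_le_rotate :
    (tetraFiber d P).ncard ≤ (tetraFiber d P.rotate).ncard := by
  refine Set.ncard_le_ncard_of_injOn
    (ConnPartition.pullback ((tetraRefined d).graphIso (refinedRotation d) refinedRotation_σ
      refinedRotation_α)) (fun Q hQ x => ?_) (ConnPartition.pullback_injective _).injOn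
      (Set.toFinite _)
  exact hQ (tetraRotation x)

theorem two_mul_ncard_unorder_le (hP : tetra.AllFacesMixed P) :
    2 * (ConnPartition.unorder '' tetraFiber d P).ncard ≤
      Fintype.card (UnorderedConnPartition (tetraRefined d).graph) := by
  have h1 := Set.ncard_union_eq (disjoint_unorder_rotate (d := d) hP) (Set.toFinite _)
    (Set.toFinite _)
  have h2 := Set.ncard_le_ncard (Set.subset_univ
    (ConnPartition.unorder '' tetraFiber d P ∪
      ConnPartition.unorder '' tetraFiber d P.rotate)) (Set.toFinite _)
  rw [Set.ncard_univ, Nat.card_eq_fintype_card, h1] at h2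
  have h3 := ncard_tetraFiber_le_rotate (d := d) (P := P)
  rw [injOn_unorder_tetraFiber.ncard_image, injOn_unorder_tetraFiber.ncard_image] at h2
  rw [injOn_unorder_tetraFiber.ncard_image]
  omega

theorem disjoint_tetraFiber_rotate (hP : tetra.AllFacesMixed P) :
    Disjoint (tetraFiber d P) (tetraFiber d P.rotate) :=
  Disjoint.of_image (disjoint_unorder_rotate hP)

theorem two_mul_ncard_tetraFiber_le (hP : tetra.AllFacesMixed P) :
    2 * (tetraFiber d P).ncard ≤
      Fintype.card (ConnPartition (tetraRefined d).graph) := by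
  have h1 := Set.ncard_union_eq (disjoint_tetraFiber_rotate (d := d) hP) (Set.toFinite _)
    (Set.toFinite _)
  have h2 := Set.ncard_le_ncard (Set.subset_univ
    (tetraFiber d P ∪ tetraFiber d P.rotate)) (Set.toFinite _)
  rw [Set.ncard_univ, Nat.card_eq_fintype_card, h1] at h2
  have h3 := ncard_tetraFiber_le_rotate (d := d) (P := P)
  omega

theorem fst_φ_φ_ne_oppVertex : ∀ x : TetraDart, (tetra.φ (tetra.φ x)).1.1 ≠ oppVertex x := by
  decide

theorem exists_corner : ∀ f p : Fin 4, p ≠ f →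
    ∃ x : TetraDart, oppVertex x = f ∧ (tetra.φ (tetra.φ x)).1.1 = p := by decide

/-- All vertices that are not original can be put into the first block. -/
theorem nonempty_tetraFiber (hP : tetra.AllFacesMixed P) :
    (tetraFiber d P).Nonempty := by
  have hm := allFacesMixed_iff.1 hP
  let B : Set (tetraRefined d).Vertex :=
    {u | ∀ x, u = levelVertex d x 0 → tetraBlock P (tetra.φ (tetra.φ x)).1.1}
  have h0 (x : TetraDart) : levelVertex d x 0 ∈ B ↔ tetraBlock P (tetra.φ (tetra.φ x)).1.1 := by
    constructor
    · exact fun h => h x rfl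
    · intro h y hy
      rwa [← levelVertex_zero_eq_iff.1 hy]
  have h1 (x : TetraDart) (j : ℕ) (hj : j ≤ d) : levelVertex d x (j + 1) ∈ B := by
    intro y hy
    have := level_eq_of_levelKey_eq ((levelVertex_eq_iff (by omega) (by omega)).1 hy)
    omega
  have hB : IsConnSplit (tetraRefined d).graph B := by
    refine isConnSplit_of_rooted fun u => ?_
    obtain ⟨x, j, hj, rfl⟩ := exists_levelVertex_eq u
    refine rooted_of_steps (f := oppVertex x) (fun y k hy hk => ?_) j hj x rfl
    obtain ⟨z, hz, hzB⟩ : ∃ z, oppVertex z = oppVertex x ∧ levelVertex d z k ∈ B := by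
      cases k with
      | zero =>
        obtain ⟨p, hp, hpP⟩ := (hm (oppVertex x)).1
        obtain ⟨z, hz, rfl⟩ := exists_corner _ p hp
        exact ⟨z, hz, (h0 z).2 hpP⟩
      | succ k => exact ⟨y, hy, h1 y k (by omega)⟩
    exact ⟨tetra.φ z, z, by rw [Tetra.oppVertex_φ, hz], hz, Tetra.φ_ne z,
      by simp only [h1 _ k hk], by simp only [h1 _ k hk, hzB]⟩
  exact ⟨⟨B, hB⟩, mem_tetraFiber_iff.2 h0⟩

theorem exists_original_of_flip_notMem {Q : ConnPartition (tetraRefined d).graph}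
    (hQ : Q ∈ tetraFiber d P) {v : (tetraRefined d).Vertex}
    (h : Q.flip v ∉ tetraFiber d P) :
    IsConnSplit (tetraRefined d).graph (Q.block ∆ {v}) ∧ ∃ x, v = levelVertex d x 0 := by
  by_cases hc : IsConnSplit (tetraRefined d).graph (Q.block ∆ {v})
  · refine ⟨hc, ?_⟩
    by_contra hv
    push Not at hv
    refine h ?_
    rw [ConnPartition.flip, dif_pos hc, mem_tetraFiber_iff]
    intro x
    rw [← mem_tetraFiber_iff.1 hQ x]
    simp [Set.mem_symmDiff, (hv x).symm]
  · rw [ConnPartition.flip, dif_neg hc] at h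
    exact (h hQ).elim

/-- When an original vertex moves to the other block, one face of `K_4` ceases to be mixed. Its
inside could not be connected to the fourth vertex of `K_4`, so it lies in the block of its other
two corners. -/
theorem mem_iff_of_inFace {Q : ConnPartition (tetraRefined d).graph}
    (hQ : Q ∈ tetraFiber d P) {x : TetraDart}
    (hc : IsConnSplit (tetraRefined d).graph (Q.block ∆ {levelVertex d x 0})) {w : Fin 4}
    (hw : w ≠ (tetra.φ (tetra.φ x)).1.1)
    (hwv : tetraBlock P w ↔ tetraBlock P (tetra.φ (tetra.φ x)).1.1)
    (hu : ∀ u, u ≠ (tetra.φ (tetra.φ x)).1.1 → u ≠ w →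
      (tetraBlock P u ↔ ¬ tetraBlock P (tetra.φ (tetra.φ x)).1.1))
    {u : (tetraRefined d).Vertex} (huf : InFace d w u) :
    u ∈ Q.block ↔ ¬ tetraBlock P (tetra.φ (tetra.φ x)).1.1 := by
  rw [mem_tetraFiber_iff] at hQ
  set B' := Q.block ∆ {levelVertex d x 0} with hB'
  have hmem {a : (tetraRefined d).Vertex} (ha : a ≠ levelVertex d x 0) :
      a ∈ B' ↔ a ∈ Q.block := by simp [hB', Set.mem_symmDiff, ha]
  have hmem0 : levelVertex d x 0 ∈ B' ↔ levelVertex d x 0 ∉ Q.block := by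
    simp [hB', Set.mem_symmDiff]
  have hne {a : (tetraRefined d).Vertex} (ha : InFace d w a) : a ≠ levelVertex d x 0 :=
    fun e => not_inFace_level_zero w x (e ▸ ha)
  by_contra hcon
  have hcol : u ∈ B' ↔ tetraBlock P (tetra.φ (tetra.φ x)).1.1 := by
    rw [hmem (hne huf)]; tauto
  obtain ⟨y, hy⟩ : ∃ y : TetraDart, (tetra.φ (tetra.φ y)).1.1 = w := by
    have h : ∀ w : Fin 4, ∃ y : TetraDart, (tetra.φ (tetra.φ y)).1.1 = w := by decide
    exact h w
  have hyne : levelVertex d y 0 ≠ levelVertex d x 0 := by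
    rw [Ne, levelVertex_zero_eq_iff, hy]; exact hw
  have hpath := isConnSplit_iff.1 hc u (levelVertex d y 0) (by
    rw [hcol, hmem hyne, hQ, hy, hwv])
  have hstay : ∀ a, Relation.ReflTransGen (SameSide (tetraRefined d).graph B') u a →
      InFace d w a := by
    intro a ha
    induction ha with
    | refl => exact huf
    | @tail b c hub hbc ih =>
      rcases ih.adj hbc.1 with h | ⟨z, hz, rfl⟩
      · exact h
      · exfalso
        have hb := (mem_iff_of_reflTransGen_sameSide (hub.tail hbc)).symm.trans hcol
        have hzw : (tetra.φ (tetra.φ z)).1.1 ≠ w := hz ▸ fst_φ_φ_ne_oppVertex z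
        by_cases hzx : levelVertex d z 0 = levelVertex d x 0
        · rw [hzx, hmem0, hQ] at hb
          tauto
        · rw [hmem hzx, hQ, hu _ (fun e => hzx (levelVertex_zero_eq_iff.2 e)) hzw] at hb
          tauto
  exact not_inFace_level_zero w y (hstay _ hpath)

/-- The sequence of colourings that starts at `s` and in which each of the first `d` steps passes to
one of the five other mixed colourings, as the word `w` says. -/
def colorSequence (s : Fin 6) (w : Fin d → Fin 5) : ℕ → Fin 6
  | 0 => s
  | j + 1 => colorSequence s w j + if h : j < d then (w ⟨j, h⟩).succ else 0

theorem colorSequence_ne (s : Fin 6) (w : Fin d → Fin 5) {j : ℕ} (hj : j < d) :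
    colorSequence s w j ≠ colorSequence s w (j + 1) := by
  rw [colorSequence, dif_pos hj]
  intro h
  exact (Fin.succ_ne_zero _) (left_eq_add.1 h)

theorem eq_of_colorSequence_eq {s : Fin 6} {w w' : Fin d → Fin 5}
    (h : ∀ j ≤ d, colorSequence s w j = colorSequence s w' j) : w = w' := by
  ext1 ⟨j, hj⟩
  have h1 := h (j + 1) hj
  rw [colorSequence, colorSequence, h j hj.le, dif_pos hj, dif_pos hj] at h1
  exact Fin.succ_injective _ (add_left_cancel h1)

/-- Recolouring the face that ceases to be mixed gives `5 ^ d` partitions for each exit. -/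
theorem ncard_exit_mul_le (hP : tetra.AllFacesMixed P) (x : TetraDart) :
    {Q | Q ∈ tetraFiber d P ∧
      Q.flip (levelVertex d x 0) ∉ tetraFiber d P}.ncard * 5 ^ d ≤
      (tetraFiber d P).ncard := by
  classical
  have hm := allFacesMixed_iff.1 hP
  obtain ⟨f, hf, hfv, hfu⟩ := exists_partner hm (tetra.φ (tetra.φ x)).1.1
  set E := {Q | Q ∈ tetraFiber d P ∧
      Q.flip (levelVertex d x 0) ∉ tetraFiber d P} with hE
  obtain ⟨s, hs⟩ : ∃ s, ∀ y, oppVertex y = f →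
      (tetraBlock P (tetra.φ (tetra.φ y)).1.1 ↔ mixedColoring s (cornerIndex y) = true) := by
    choose c hc using exists_cornerIndex_eq f
    have hcy (y : TetraDart) (hy : oppVertex y = f) : c (cornerIndex y) = y :=
      cornerIndex_injOn _ _ ((hc _).1.trans hy.symm) (hc _).2
    obtain ⟨⟨p, hp, hpP⟩, ⟨q, hq, hqP⟩⟩ := hm f
    obtain ⟨y, hy, rfl⟩ := exists_corner f p hp
    obtain ⟨z, hz, rfl⟩ := exists_corner f q hq
    obtain ⟨s, hs⟩ := exists_mixedColoring_eq
      (fun k => decide (tetraBlock P (tetra.φ (tetra.φ (c k))).1.1))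
      ⟨cornerIndex y, by rw [hcy y hy]; simpa using hpP⟩
      ⟨cornerIndex z, by rw [hcy z hz]; simpa using hqP⟩
    exact ⟨s, fun y hy => by rw [hs, hcy y hy]; simp⟩
  have hin (Q : E) (u) (hu : InFace d f u) :
      u ∈ Q.1.block ↔ ¬ tetraBlock P (tetra.φ (tetra.φ x)).1.1 :=
    mem_iff_of_inFace Q.2.1 (exists_original_of_flip_notMem Q.2.1 Q.2.2).1 hf hfv hfu hu
  have hcorner (Q : E) := mem_tetraFiber_iff.1 Q.2.1
  have hs0 (Q : E) (w : Fin d → Fin 5) (y : TetraDart) (hy : oppVertex y = f) :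
      levelVertex d y 0 ∈ Q.1.block ↔
        mixedColoring (colorSequence s w 0) (cornerIndex y) = true := by
    rw [hcorner, hs y hy]; rfl
  have hconn (Q : E) (w : Fin d → Fin 5) :
      IsConnSplit (tetraRefined d).graph (recolor f Q.1.block (colorSequence s w)) := by
    obtain ⟨⟨p, hp, hpP⟩, ⟨q, hq, hqP⟩⟩ := hm f
    obtain ⟨y, hy, rfl⟩ := exists_corner f p hp
    obtain ⟨z, hz, rfl⟩ := exists_corner f q hq
    exact isConnSplit_recolor Q.1.conn ⟨y, (hcorner Q y).2 hpP⟩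
      ⟨z, fun h => hqP ((hcorner Q z).1 h)⟩ (hs0 Q w) fun j hj => colorSequence_ne s w hj
  let F : E × (Fin d → Fin 5) → tetraFiber d P := fun q =>
    ⟨⟨recolor f q.1.1.block (colorSequence s q.2), hconn q.1 q.2⟩,
      mem_tetraFiber_iff.2 fun y => by
        rw [← hcorner q.1]
        exact mem_recolor_of_not_inFace (not_inFace_level_zero f y)⟩
  have hF : Function.Injective F := by
    rintro ⟨Q, w⟩ ⟨Q', w'⟩ h
    have hb : recolor f Q.1.block (colorSequence s w) =
        recolor f Q'.1.block (colorSequence s w') :=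
      congrArg (fun R : tetraFiber d P => R.1.block) h
    have hQ : Q = Q' := by
      refine Subtype.ext (ConnPartition.ext (Set.ext fun u => ?_))
      by_cases hu : InFace d f u
      · rw [hin Q u hu, hin Q' u hu]
      · rw [← mem_recolor_of_not_inFace (s := colorSequence s w) hu, hb,
          mem_recolor_of_not_inFace hu]
    have hw : w = w' := eq_of_colorSequence_eq fun j hj => mixedColoring_injective _ _ fun k => by
      obtain ⟨y, hy, rfl⟩ := exists_cornerIndex_eq f k
      have h1 := level_mem_recolor (hs0 Q w) hy hj
      have h2 := level_mem_recolor (hs0 Q' w') hy hj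
      rw [hb] at h1
      rw [Bool.eq_iff_iff, ← h1, h2]
    rw [hQ, hw]
  have := Nat.card_le_card_of_injective F hF
  rw [Nat.card_prod, Nat.card_coe_set_eq, Nat.card_coe_set_eq] at this
  simpa [Nat.card_eq_fintype_card] using this

theorem escapeRatio_tetraFiber_le (hP : tetra.AllFacesMixed P) :
    escapeRatio (flipWalk (tetraRefined d).graph) (tetraFiber d P) ≤
      (1 / 2) * (5 ^ 3 / 5 ^ d) := by
  classical
  have hV := card_vertex (d := d)
  have : Nonempty (tetraRefined d).Vertex := (Nat.card_pos_iff.1 (by omega)).1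
  have h := escapeRatio_flipWalk_le (nonempty_tetraFiber (d := d) hP)
    (Finset.univ.image fun x : TetraDart => levelVertex d x 0) (N := 5 ^ d) (by positivity)
    (fun Q hQ v hv => by
      obtain ⟨x, rfl⟩ := (exists_original_of_flip_notMem hQ hv).2
      simp)
    (fun v hv => by
      obtain ⟨x, -, rfl⟩ := Finset.mem_image.1 hv
      exact ncard_exit_mul_le hP x)
  refine h.trans ?_
  have hS : (Finset.univ.image fun x : TetraDart => levelVertex d x 0).card ≤ 12 :=
    Finset.card_image_le.trans (by decide)
  have hS' : ((Finset.univ.image fun x : TetraDart => levelVertex d x 0).card : ℝ) ≤ 12 := by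
    exact_mod_cast hS
  have hn : (8 : ℝ) ≤ Nat.card (tetraRefined d).Vertex := by
    rw [hV]; push_cast; linarith [(Nat.cast_nonneg d : (0 : ℝ) ≤ d)]
  have h5 : (0 : ℝ) < 5 ^ d := by positivity
  rw [div_le_iff₀ (by positivity)]
  push_cast
  have : (1 / 2 : ℝ) * (5 ^ 3 / 5 ^ d) * (2 * Nat.card (tetraRefined d).Vertex * 5 ^ d) =
      125 * Nat.card (tetraRefined d).Vertex := by
    field_simp; norm_num
  rw [this]
  linarith

theorem isBottleneck_tetraFiber (hP : tetra.AllFacesMixed P) :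
    IsBottleneck (flipWalk (tetraRefined d).graph) (tetraFiber d P)
      ((1 / 2) * (5 ^ 3 / 5 ^ d)) :=
  ⟨nonempty_tetraFiber hP, two_mul_ncard_tetraFiber_le hP,
    escapeRatio_tetraFiber_le hP⟩

theorem isBottleneck_unorder_tetraFiber (hP : tetra.AllFacesMixed P) :
    IsBottleneck (unorderedFlipWalk (tetraRefined d).graph)
      (ConnPartition.unorder '' tetraFiber d P) ((1 / 2) * (5 ^ 3 / 5 ^ d)) :=
  ⟨(nonempty_tetraFiber hP).image _, two_mul_ncard_unorder_le hP,
    (escapeRatio_unorderedFlipWalk_le _ injOn_unorder_tetraFiber).trans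
      (escapeRatio_tetraFiber_le hP)⟩

end Fiber

/-! ### The mixing times -/

theorem le_mixingTime_of_bottlenecks {Ω : Type} [Fintype Ω] [DecidableEq Ω] {K : Matrix Ω Ω ℝ}
    (hK : IsSymmStochastic K) {U W : Set Ω} {d : ℕ}
    (hU : IsBottleneck K U ((1 / 2) * (5 ^ 3 / 5 ^ d)))
    (hW : IsBottleneck K W ((1 / 2) * (5 ^ 3 / 5 ^ d))) (hUW : Disjoint U W)
    {μ : Ω → ℝ} (hμ : IsStationaryDist K μ) :
    (5 : ℝ≥0∞) ^ d / 250 ≤ mixingTime K μ (1 / 4) := by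
  refine le_iInf₂ fun t ht => ?_
  have h := hK.le_mixingTime hU.1 hW.1 hUW hU.2.2 hW.2.2 hμ t ht
  have h5 : (0 : ℝ) < 5 ^ d := by positivity
  have h2 : (5 : ℝ) ^ d ≤ t * 250 := by
    have : (t : ℝ) * (1 / 2 * (5 ^ 3 / 5 ^ d)) = t * 125 / (2 * 5 ^ d) := by
      field_simp; norm_num
    rw [this, le_div_iff₀ (by positivity)] at h
    linarith
  refine ENNReal.div_le_of_le_mul ?_
  exact_mod_cast h2

theorem mainTheorem5 :
    (∀ d : ℕ,
      (tetraRefined d).IsTriangulation ∧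
      IsMaximalPlanar (tetraRefined d).graph ∧
      ∀ v, ((tetraRefined d).graph.neighborSet v).ncard ≤ 9) ∧
    ((fun d : ℕ => (Nat.card (tetraRefined d).Vertex : ℝ)) =O[Filter.atTop]
      fun d : ℕ => (d : ℝ)) ∧
    (∀ d : ℕ,
      IsStationaryDist (flipWalk (tetraRefined d).graph) (uniformDist _) ∧
      (∀ μ, IsStationaryDist (flipWalk (tetraRefined d).graph) μ →
        (5 : ℝ≥0∞) ^ d / 250 ≤ mixingTime (flipWalk (tetraRefined d).graph) μ (1 / 4)) ∧
      IsStationaryDist (unorderedFlipWalk (tetraRefined d).graph) (uniformDist _) ∧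
      (∀ μ, IsStationaryDist (unorderedFlipWalk (tetraRefined d).graph) μ →
        (5 : ℝ≥0∞) ^ d / 250 ≤ mixingTime (unorderedFlipWalk (tetraRefined d).graph) μ (1 / 4))) ∧
    (∃ P : ConnPartition tetra.graph, tetra.AllFacesMixed P) ∧
    (∀ (d : ℕ) (P : ConnPartition tetra.graph), tetra.AllFacesMixed P →
      IsBottleneck (flipWalk (tetraRefined d).graph)
        (tetra.restrictionFiber d P) ((1 / 2) * (5 ^ 3 / 5 ^ d)) ∧
      IsBottleneck (unorderedFlipWalk (tetraRefined d).graph)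
        (ConnPartition.unorder '' tetra.restrictionFiber d P) ((1 / 2) * (5 ^ 3 / 5 ^ d))) := by
  refine ⟨fun d => ⟨tetraRefined_isTriangulation d,
    (tetraRefined_isTriangulation d).isMaximalPlanar, ncard_neighborSet_le⟩, ?_, fun d => ?_,
    exists_allFacesMixed,
    fun d P hP => ⟨isBottleneck_tetraFiber hP, isBottleneck_unorder_tetraFiber hP⟩⟩
  · refine Asymptotics.IsBigO.of_bound 20 ?_
    filter_upwards [Filter.eventually_ge_atTop 1] with d hd
    rw [card_vertex, Real.norm_natCast, Real.norm_natCast]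
    exact_mod_cast (by omega : 12 * d + 8 ≤ 20 * d)
  · obtain ⟨P, hP⟩ := exists_allFacesMixed
    have hP' := allFacesMixed_rotate hP
    obtain ⟨Q, -⟩ := nonempty_tetraFiber (d := d) hP
    have : Nonempty (ConnPartition (tetraRefined d).graph) := ⟨Q⟩
    have : Nonempty (UnorderedConnPartition (tetraRefined d).graph) := ⟨Q.unorder⟩
    have hV := card_vertex (d := d)
    have : Nonempty (tetraRefined d).Vertex := (Nat.card_pos_iff.1 (by omega)).1
    have hK := isSymmStochastic_flipWalk (tetraRefined d).graph
    have hK' := isSymmStochastic_unorderedFlipWalk (tetraRefined d).graph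
    exact ⟨hK.isStationaryDist_uniformDist, fun μ hμ => le_mixingTime_of_bottlenecks hK
        (isBottleneck_tetraFiber hP) (isBottleneck_tetraFiber hP')
        (disjoint_tetraFiber_rotate hP) hμ,
      hK'.isStationaryDist_uniformDist, fun μ hμ => le_mixingTime_of_bottlenecks hK'
        (isBottleneck_unorder_tetraFiber hP) (isBottleneck_unorder_tetraFiber hP')
        (disjoint_unorder_rotate hP) hμ⟩
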